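/- **Setting.** Let $\mu$ be the fair-coin (Lebesgue) measure on $2^\omega$; identify subsets of $\omega$ with elements of $2^\omega$, and let $(x\oplus y)(2n)=x(n)$, $(x\oplus y)(2n+1)=y(n)$. For $g,f\in\omega^\omega$ write $g\le^* f$ if $g(n)\le f(n)$ for all but finitely many $n$. A function $f\in\omega^\omega$ is *uniformly almost everywhere dominating* if $$\mu\{Z\in 2^\omega : (\forall g\in\omega^\omega)\,[\,g\le_T Z\Rightarrow g\le^* f\,]\}=1,$$ and *uniformly almost everywhere dominating over $B\subseteq\omega$* if the same holds with $g\le_T B\oplus Z$ in place of $g\le_T Z$. Let $\Psi_0,\Psi_1,\dots$ be an effective list of all Turing functionals $2^\omega\to\omega^\omega$, and let $\Phi$ be the universal partial computable functional with $\Phi(B\oplus 0^i1Y)=\Psi_i(B\oplus Y)$ whenever the right-hand side is total, equipped with stages such that $\Phi(X;n)\!\downarrow[s]$ implies $\Phi(X;n)[s]\le s$ and $\Phi(X;m)\!\downarrow[s]$ for all $m<n$. For $B\subseteq\omega$ let $\operatorname{dom}_B\Phi=\{Z\in 2^\omega:\Phi(B\oplus Z)\text{ is total}\}$, and for $n\in\omega$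 and $g\in\omega^{<\omega}$ let $$D^B_{[n,|g|)}[g]=\{Z\in 2^\omega: \Phi(B\oplus Z;k)\!\downarrow[g(k)]\text{ for all } n\le k<|g|\}.$$ The notion of forcing $\mathbb P_B$ consists of the conditions $\langle f,\epsilon\rangle$ with $f\in\omega^{<\omega}$ and $\epsilon$ a positive rational. A condition $\langle g,\delta\rangle$ extends $\langle f,\epsilon\rangle$ if $f\subseteq g$, $\delta\le\epsilon$ and, if $f\ne g$, $$\mu\bigl(\operatorname{dom}_B\Phi\smallsetminus D^B_{[|f|,|g|)}[g]\bigr)+\delta<\epsilon .$$ This is a partial order. Write $\mathbb P=\mathbb P_\emptyset$, and for a filter $G\subset\mathbb P_B$ let $f^G=\bigcup\{f:\langle f,\epsilon\rangle\in G\}$. A statement holds for all *sufficiently generic* $G\subset\mathbb P_B$ if there is a countable family of dense subsets of $\mathbb P_B$ such that the statement holds for every filter $G\subset\mathbb P_B$ that meets each member of the family. **Theorem.** 1. If $G\subset\mathbb P$ is sufficiently generic, then $f^G\in\omega^\omega$ and $f^G$ is uniformly almost everywhere dominating. 2. For every $B\subseteq\omega$: if $G\subset\mathbb P_B$ is sufficiently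 generic (the family of dense sets depending only on $B$), then $f^G\in\omega^\omega$ and $f^G$ is uniformly almost everywhere dominating over $B$. 3. For all $A,B\subseteq\omega$ with $A\not\le_T B$: if $G\subset\mathbb P_B$ is sufficiently generic over $A$ (the family of dense sets may depend on $A$ and $B$), then $f^G\in\omega^\omega$ and $A\not\le_T B\oplus f^G$. -/

import Mathlib

open MeasureTheory Filter

namespace AEDom

/-- Cantor space `2^ω`; its points are identified with subsets of `ω`. -/
abbrev Cantor : Type := ℕ → Bool

/-- Lebesgue (fair-coin) measure on `2^ω`. -/
noncomputable def coinMeasure : Measure Cantor :=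
  Measure.infinitePi fun _ : ℕ => (PMF.uniformOfFintype Bool).toMeasure

instance : IsProbabilityMeasure coinMeasure := by
  unfold coinMeasure; infer_instance

/-- The join `x ⊕ y`: `(x ⊕ y)(2n) = x n` and `(x ⊕ y)(2n+1) = y n`. -/
def join {α : Type} (x y : ℕ → α) : ℕ → α :=
  fun n => if n % 2 = 0 then x (n / 2) else y (n / 2)

/-- The characteristic function of a set, with values `0`, `1`. -/
def char (X : Cantor) : ℕ → ℕ := fun n => (X n).toNat

/-- Turing reducibility `g ≤_T h` between total functions. -/
def Reducible (g h : ℕ → ℕ) : Prop :=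
  TuringReducible (g : ℕ →. ℕ) (h : ℕ →. ℕ)

/-- `g ≤* f`: `f` dominates `g`. -/
def Dominated (g f : ℕ → ℕ) : Prop := ∀ᶠ n in atTop, g n ≤ f n

/-- `f` is uniformly almost everywhere dominating. -/
def UniformlyAEDominating (f : ℕ → ℕ) : Prop :=
  ∀ᵐ Z ∂coinMeasure, ∀ g : ℕ → ℕ, Reducible g (char Z) → Dominated g f

/-- `f` is uniformly almost everywhere dominating over `B`. -/
def UniformlyAEDominatingOver (B : Cantor) (f : ℕ → ℕ) : Prop :=
  ∀ᵐ Z ∂coinMeasure, ∀ g : ℕ → ℕ, Reducible g (char (join B Z)) → Dominated g f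

/-- An effective list `Ψ_0, Ψ_1, …` of all Turing functionals `2^ω → ω^ω`, with stages:
`Psi i X n s` is `Ψ_i(X; n)[s]`. The `i`-th partial recursive function `φ_i` is run on
pairs (finite initial segment of the oracle, input). All pairs (length `k`, number of steps `u`)
are tried in the order of their codes `t`, and the first answer found is the output;
at stage `s`, the codes `t ≤ s` have been tried. -/
def Psi (i : ℕ) (X : Cantor) (n s : ℕ) : Option ℕ :=
  (List.range (s + 1)).findSome? fun t =>
    Nat.Partrec.Code.evaln t.unpair.2 (Denumerable.ofNat Nat.Partrec.Code i)
      (Encodable.encode ((List.range t.unpair.1).map X, n))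

/-- The universal functional before normalization: on the oracle `B ⊕ 0^i 1 Y` it simulates
`Ψ_i(B ⊕ Y)`. (It diverges on `B ⊕ 0^∞`.) -/
def rawPhi (X : Cantor) (n s : ℕ) : Option ℕ :=
  ((List.range (s + 1)).find? fun i => X (2 * i + 1)).bind fun i =>
    Psi i (join (fun j => X (2 * j)) (fun j => X (2 * (i + 1 + j) + 1))) n s

/-- The universal functional `Φ`, with stages: `Phi X n s` is `Φ(X; n)[s]`. It is normalized so
that `Φ(X; n)↓[s]` implies `Φ(X; n)[s] ≤ s` and `Φ(X; m)↓[s]` for all `m < n`. -/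
def Phi (X : Cantor) (n s : ℕ) : Option ℕ :=
  if (List.range (n + 1)).all fun m => (rawPhi X m s).any fun v => decide (v ≤ s) then
    rawPhi X n s
  else none

/-- `dom Φ` relative to `B`: the set of all `Z` such that `Φ(B ⊕ Z)` is total. -/
def domPhi (B : Cantor) : Set Cantor :=
  {Z | ∀ n, ∃ s, (Phi (join B Z) n s).isSome}

/-- `D_{[n,|g|)}[g]` relative to `B`: the set of all `Z` such that
`Φ(B ⊕ Z; k)↓[g(k)]` for all `k` with `n ≤ k < |g|`. -/
def boundedBy (B : Cantor) (n : ℕ) (g : List ℕ) : Set Cantor :=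
  {Z | ∀ k, ∀ hk : k < g.length, n ≤ k → (Phi (join B Z) k g[k]).isSome}

/-- A forcing condition `⟨f, ε⟩` of `ℙ_B`. -/
@[ext]
structure Condition (B : Cantor) where
  stem : List ℕ
  eps : ℚ
  eps_pos : 0 < eps

/-- `q` extends `p`. -/
def Condition.Extends {B : Cantor} (q p : Condition B) : Prop :=
  p.stem <+: q.stem ∧ q.eps ≤ p.eps ∧
    (p.stem ≠ q.stem →
      coinMeasure.real (domPhi B \ boundedBy B p.stem.length q.stem) + (q.eps : ℝ) < (p.eps : ℝ))

theorem Condition.Extends.trans {B : Cantor} {r q p : Condition B}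
    (h₁ : r.Extends q) (h₂ : q.Extends p) : r.Extends p := by
  obtain ⟨a₁, b₁, c₁⟩ := h₁
  obtain ⟨a₂, b₂, c₂⟩ := h₂
  refine ⟨a₂.trans a₁, b₁.trans b₂, fun hne => ?_⟩
  by_cases e₁ : q.stem = r.stem
  · have h := c₂ (e₁ ▸ hne)
    rw [e₁] at h
    have : (r.eps : ℝ) ≤ q.eps := by exact_mod_cast b₁
    linarith
  by_cases e₂ : p.stem = q.stem
  · have h := c₁ e₁
    rw [← e₂] at h
    have : (q.eps : ℝ) ≤ p.eps := by exact_mod_cast b₂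
    linarith
  have h₁ := c₁ e₁
  have h₂ := c₂ e₂
  have hsub : domPhi B \ boundedBy B p.stem.length r.stem ⊆
      (domPhi B \ boundedBy B p.stem.length q.stem) ∪
        (domPhi B \ boundedBy B q.stem.length r.stem) := by
    rintro Z ⟨hZ, hZ'⟩
    by_contra hcon
    simp only [Set.mem_union, Set.mem_sdiff, not_or, not_and, not_not] at hcon
    obtain ⟨u, v⟩ := hcon
    refine hZ' fun k hk hn => ?_
    by_cases hkq : k < q.stem.length
    · have := u hZ k hkq hn
      rwa [a₁.getElem hkq] at this
    · exact v hZ k hk (not_lt.mp hkq)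
  have hm := (measureReal_mono hsub (measure_ne_top coinMeasure _)).trans
    (measureReal_union_le (μ := coinMeasure) _ _)
  linarith

/-- The partial order `ℙ_B`; `q ≤ p` means that `q` extends `p`. -/
instance (B : Cantor) : PartialOrder (Condition B) where
  le q p := q.Extends p
  le_refl p := ⟨List.prefix_refl _, le_refl _, fun h => absurd rfl h⟩
  le_trans _ _ _ h₁ h₂ := Condition.Extends.trans h₁ h₂
  le_antisymm _ _ h₁ h₂ :=
    Condition.ext (h₂.1.eq_of_length (le_antisymm h₂.1.length_le h₁.1.length_le))
      (le_antisymm h₁.2.1 h₂.2.1)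

/-- `D` is dense in a notion of forcing. -/
def ForcingDense {P : Type} [Preorder P] (D : Set P) : Prop := ∀ p, ∃ q ∈ D, q ≤ p

/-- `Q` holds of every sufficiently generic filter: for some countable family of dense sets,
`Q` holds of all filters that meet every member of the family. -/
def ForSufficientlyGeneric {P : Type} [Preorder P] (Q : Order.PFilter P → Prop) : Prop :=
  ∃ 𝒟 : Set (Set P), 𝒟.Countable ∧ (∀ D ∈ 𝒟, ForcingDense D) ∧
    ∀ G : Order.PFilter P, (∀ D ∈ 𝒟, ∃ p ∈ D, p ∈ G) → Q G

/-- The union `f^G` of the strings of the conditions in `G` is the total function `f`. -/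
def IsGenericFunction {B : Cantor} (G : Order.PFilter (Condition B)) (f : ℕ → ℕ) : Prop :=
  ∀ n m, f n = m ↔ ∃ p ∈ G, p.stem[n]? = some m

end AEDom

/-! A condition `⟨f, ε⟩` promises that however `f` is prolonged, the new values fail to bound the
convergence of `Φ(B ⊕ Z)` only for a set of `Z ∈ dom Φ` of measure less than `ε`. Stems can always
be lengthened, since any `Z ∈ dom Φ` converges at some stage, and `ε` can always be shrunk. Hence
for almost every `W ∈ dom Φ`, `Φ(B ⊕ W; k)` converges by stage `f^G(k)` for almost all `k`
(`IsGenericFunction.ae_eventually_mem_stage`). If `g ≤_T B ⊕ Z` has index `i`, this is applied to `W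
= 0^i 1 Z`. Prefixing finitely many bits pulls null sets back to null sets (`ae_codeIndex`), and
normalization makes values at most the stage, so `f^G` dominates `g`.

For cone avoidance, each functional must be forced to err or to diverge (`forcingDense_avoids`). If
this were impossible below `⟨f, ε⟩`, then `A` could be computed from `B` by searching for a string
extending `f` that gives an answer. The obstacle is that "extends `⟨f, ε⟩`" mentions `dom Φ`, which
is not decidable from `B`. So `dom Φ` is replaced by a clopen set `stage B n₀ s₀` close to it in
measure (`exists_stage_approx`). The measures are then dyadic rationals, found by counting strings
with finitely many bits of `B`, and the slack in `ε` absorbs the approximation error. -/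

namespace AEDom

/-! ### The use principle -/

/-- The initial segment of length `k` of `h`. -/
def initSeg {α : Type} (h : ℕ → α) (k : ℕ) : List α := (List.range k).map h

theorem initSeg_prefix {α : Type} (h : ℕ → α) {k l : ℕ} (hkl : k ≤ l) :
    initSeg h k <+: initSeg h l := by
  obtain ⟨d, rfl⟩ := Nat.exists_eq_add_of_le hkl
  simp [initSeg, List.range_add]

theorem initSeg_getElem? {α : Type} (h : ℕ → α) {k n : ℕ} (hn : n < k) :
    (initSeg h k)[n]? = some (h n) := by
  simp [initSeg, hn]

theorem initSeg_getD {α : Type} (h : ℕ → α) (d : α) {k n : ℕ} (hn : n < k) :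
    (initSeg h k).getD n d = h n := by
  simp [initSeg, hn]

/-- A functional on finite oracles that respects extension of oracles. -/
def MonotoneFunctional (F : List ℕ → ℕ →. ℕ) : Prop :=
  ∀ ⦃σ τ : List ℕ⦄, σ <+: τ → ∀ n, ∀ v ∈ F σ n, v ∈ F τ n

/-- The functional `F` computes `f` from the oracle `h`. -/
def Computes (F : List ℕ → ℕ →. ℕ) (h : ℕ → ℕ) (f : ℕ →. ℕ) : Prop :=
  ∀ n, ∀ v ∈ f n, ∃ k, v ∈ F (initSeg h k) n

theorem MonotoneFunctional.mem_initSeg {F : List ℕ → ℕ →. ℕ} (hF : MonotoneFunctional F)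
    {h : ℕ → ℕ} {k l n v : ℕ} (hkl : k ≤ l) (hv : v ∈ F (initSeg h k) n) :
    v ∈ F (initSeg h l) n :=
  hF (initSeg_prefix h hkl) n v hv

theorem MonotoneFunctional.unique {F : List ℕ → ℕ →. ℕ} (hF : MonotoneFunctional F)
    {h : ℕ → ℕ} {k l n v w : ℕ} (hv : v ∈ F (initSeg h k) n) (hw : w ∈ F (initSeg h l) n) :
    v = w :=
  Part.mem_unique (hF.mem_initSeg (le_max_left k l) hv) (hF.mem_initSeg (le_max_right k l) hw)

theorem exists_monotoneFunctional_of_partrec {f : ℕ →. ℕ} (hf : Nat.Partrec f) (h : ℕ → ℕ) :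
    ∃ F : List ℕ → ℕ →. ℕ, Partrec₂ F ∧ MonotoneFunctional F ∧ Computes F h f :=
  ⟨fun _ n => f n, (Partrec.nat_iff.2 hf).comp Computable.snd, fun _ _ _ _ _ hv => hv,
    fun _ _ hv => ⟨0, hv⟩⟩

/-- By induction on the derivation of `f`: an oracle call becomes a lookup in a finite list,
undefined past its end. Monotonicity allows the uses of subcomputations to be combined by taking
their maximum. Only one inclusion between `f` and the functional is recorded; for total `f` the
other follows from `MonotoneFunctional.unique`. -/
theorem exists_monotoneFunctional {h : ℕ → ℕ} {f : ℕ →. ℕ}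
    (hf : Nat.RecursiveIn {(h : ℕ →. ℕ)} f) :
    ∃ F : List ℕ → ℕ →. ℕ, Partrec₂ F ∧ MonotoneFunctional F ∧ Computes F h f := by
  induction hf with
  | zero => exact exists_monotoneFunctional_of_partrec .zero h
  | succ => exact exists_monotoneFunctional_of_partrec .succ h
  | left => exact exists_monotoneFunctional_of_partrec .left h
  | right => exact exists_monotoneFunctional_of_partrec .right h
  | oracle g hg =>
    obtain rfl : g = h := hg
    refine ⟨fun σ n => (σ[n]? : Option ℕ),
      Computable.ofOption (f := fun p : List ℕ × ℕ => p.1[p.2]?) Primrec.list_getElem?.to_comp,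
      fun σ τ hst n v hv => ?_, fun n v hv => ⟨n + 1, ?_⟩⟩
    · replace hv : σ[n]? = some v := Part.mem_coe.1 hv
      refine Part.mem_coe.2 (?_ : τ[n]? = some v)
      obtain ⟨ρ, rfl⟩ := hst
      rw [List.getElem?_append_left (List.getElem?_eq_some_iff.1 hv).1, hv]
    · simp only [PFun.coe_val, Part.mem_some_iff] at hv
      subst hv
      exact Part.mem_coe.2 (initSeg_getElem? h n.lt_succ_self)
  | pair _ _ ihf ihg =>
    obtain ⟨F, pF, mF, cF⟩ := ihf
    obtain ⟨G, pG, mG, cG⟩ := ihg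
    refine ⟨fun σ n => (F σ n).bind fun a => (G σ n).map fun b => Nat.pair a b,
      Partrec.bind pF (Partrec.map
        (pG.comp (Computable.fst.comp Computable.fst) (Computable.snd.comp Computable.fst))
        (Primrec₂.natPair.to_comp.comp (Computable.snd.comp Computable.fst) Computable.snd)),
      fun σ τ hst n v hv => ?_, fun n v hv => ?_⟩
    · simp only [Part.mem_bind_iff, Part.mem_map_iff] at hv ⊢
      obtain ⟨a, ha, b, hb, rfl⟩ := hv
      exact ⟨a, mF hst _ _ ha, b, mG hst _ _ hb, rfl⟩
    · simp only [Seq.seq, Part.map_eq_map, Part.mem_bind_iff, Part.mem_map_iff] at hv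
      obtain ⟨_, ⟨a, ha, rfl⟩, b, hb, rfl⟩ := hv
      obtain ⟨k, hk⟩ := cF _ _ ha
      obtain ⟨l, hl⟩ := cG _ _ hb
      refine ⟨max k l, ?_⟩
      simp only [Part.mem_bind_iff, Part.mem_map_iff]
      exact ⟨a, mF.mem_initSeg (le_max_left _ _) hk, b, mG.mem_initSeg (le_max_right _ _) hl, rfl⟩
  | comp _ _ ihf ihg =>
    obtain ⟨F, pF, mF, cF⟩ := ihf
    obtain ⟨G, pG, mG, cG⟩ := ihg
    refine ⟨fun σ n => (G σ n).bind (F σ), Partrec.bind pG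
      (pF.comp (Computable.fst.comp Computable.fst) Computable.snd),
      fun σ τ hst n v hv => ?_, fun n v hv => ?_⟩
    · obtain ⟨a, ha, hb⟩ := Part.mem_bind_iff.1 hv
      exact Part.mem_bind_iff.2 ⟨a, mG hst _ _ ha, mF hst _ _ hb⟩
    · obtain ⟨a, ha, hb⟩ := Part.mem_bind_iff.1 hv
      obtain ⟨k, hk⟩ := cG _ _ ha
      obtain ⟨l, hl⟩ := cF _ _ hb
      exact ⟨max k l, Part.mem_bind_iff.2
        ⟨a, mG.mem_initSeg (le_max_left _ _) hk, mF.mem_initSeg (le_max_right _ _) hl⟩⟩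
  | prec _ _ ihf ihg =>
    obtain ⟨F, pF, mF, cF⟩ := ihf
    obtain ⟨G, pG, mG, cG⟩ := ihg
    refine ⟨fun σ p => Nat.rec (motive := fun _ => Part ℕ) (F σ p.unpair.1) (fun y IH => IH.bind fun i =>
        G σ (Nat.pair p.unpair.1 (Nat.pair y i))) p.unpair.2,
      Partrec.nat_rec (α := List ℕ × ℕ) (f := fun q => q.2.unpair.2)
        (g := fun q => F q.1 q.2.unpair.1)
        (h := fun q z => G q.1 (Nat.pair q.2.unpair.1 (Nat.pair z.1 z.2)))
        (Computable.snd.comp (Computable.unpair.comp Computable.snd))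
        (pF.comp Computable.fst (Computable.fst.comp (Computable.unpair.comp Computable.snd)))
        (pG.comp (Computable.fst.comp Computable.fst) (Primrec₂.natPair.to_comp.comp
          (Computable.fst.comp (Computable.unpair.comp (Computable.snd.comp Computable.fst)))
          (Primrec₂.natPair.to_comp.comp (Computable.fst.comp Computable.snd)
            (Computable.snd.comp Computable.snd)))),
      fun σ τ hst p => ?_, fun p => ?_⟩
    · dsimp only
      generalize p.unpair.1 = a
      induction p.unpair.2 with
      | zero => exact fun v hv => mF hst _ _ hv
      | succ y ih =>
        intro v hv
        simp only [Part.mem_bind_iff] at hv ⊢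
        obtain ⟨i, hi, hv⟩ := hv
        exact ⟨i, ih _ hi, mG hst _ _ hv⟩
    · dsimp only
      generalize p.unpair.1 = a
      induction p.unpair.2 with
      | zero => exact fun v hv => cF _ _ hv
      | succ y ih =>
        intro v hv
        simp only [Part.bind_eq_bind, Part.mem_bind_iff] at hv ⊢
        obtain ⟨i, hi, hv⟩ := hv
        obtain ⟨k, hk⟩ := ih _ hi
        obtain ⟨l, hl⟩ := cG _ _ hv
        refine ⟨max k l, i, ?_, mG.mem_initSeg (le_max_right _ _) hl⟩
        have hst := initSeg_prefix h (le_max_left k l)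
        clear hv hl hi ih
        -- The whole recursion up to `y` has to be moved to the longer initial segment, so
        -- monotonicity is carried through each of its steps.
        induction y generalizing i with
        | zero => exact mF hst _ _ hk
        | succ y ih =>
          simp only [Part.mem_bind_iff] at hk ⊢
          obtain ⟨j, hj, hk⟩ := hk
          exact ⟨j, ih _ hj, mG hst _ _ hk⟩
  | rfind _ ihf =>
    obtain ⟨F, pF, mF, cF⟩ := ihf
    refine ⟨fun σ a => Nat.rfind fun n => (F σ (Nat.pair a n)).map fun m => decide (m = 0),
      Partrec.rfind (Partrec.map (pF.comp (Computable.fst.comp Computable.fst)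
        (Primrec₂.natPair.to_comp.comp (Computable.snd.comp Computable.fst) Computable.snd))
        (Computable.comp (f := fun m : ℕ => decide (m = 0))
          (Primrec.eq.comp Primrec.id (Primrec.const 0)).decide.to_comp Computable.snd)),
      fun σ τ hst p v hv => ?_, fun p v hv => ?_⟩
    · have hv := Nat.mem_rfind.1 hv
      simp only [Part.mem_map_iff] at hv
      obtain ⟨⟨a, ha, e⟩, hv⟩ := hv
      refine Nat.mem_rfind.2 ?_
      simp only [Part.mem_map_iff]
      exact ⟨⟨a, mF hst _ _ ha, e⟩, fun hm => let ⟨b, hb, e⟩ := hv hm; ⟨b, mF hst _ _ hb, e⟩⟩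
    · have hv := Nat.mem_rfind.1 hv
      simp only [Part.mem_map_iff, Part.map_eq_map] at hv
      obtain ⟨⟨a, ha, e⟩, hv⟩ := hv
      obtain ⟨k, hk⟩ := cF _ _ ha
      have : ∀ m, ∃ l, m < v → ∃ b ∈ F (initSeg h l) (Nat.pair p m), decide (b = 0) = false := by
        intro m
        by_cases hm : m < v
        · obtain ⟨b, hb, e⟩ := hv hm
          obtain ⟨l, hl⟩ := cF _ _ hb
          exact ⟨l, fun _ => ⟨b, hl, e⟩⟩
        · exact ⟨0, fun h => absurd h hm⟩
      choose l hl using this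
      -- Only the finitely many tests below `v` and the one at `v` matter, so one initial segment
      -- serves them all.
      refine ⟨max k ((Finset.range v).sup l), Nat.mem_rfind.2 ?_⟩
      simp only [Part.mem_map_iff]
      refine ⟨⟨a, mF.mem_initSeg (le_max_left _ _) hk, e⟩, fun {m} hm => ?_⟩
      obtain ⟨b, hb, e⟩ := hl m hm
      exact ⟨b, mF.mem_initSeg ((Finset.le_sup (Finset.mem_range.2 hm)).trans
        (le_max_right _ _)) hb, e⟩

theorem Reducible.exists_functional {g h : ℕ → ℕ} (H : Reducible g h) :
    ∃ F : List ℕ → ℕ →. ℕ, Partrec₂ F ∧ MonotoneFunctional F ∧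
      ∀ n, ∃ k, g n ∈ F (initSeg h k) n := by
  obtain ⟨F, pF, mF, cF⟩ := exists_monotoneFunctional (RecursiveIn.iff_nat.1 H)
  exact ⟨F, pF, mF, fun n => cF n (g n) (by simp)⟩

/-! ### Reductions by search -/

theorem recursiveIn_comp {O : Set (ℕ →. ℕ)} {f g : ℕ → ℕ} (hf : Nat.RecursiveIn O f)
    (hg : Nat.RecursiveIn O g) : Nat.RecursiveIn O (fun n => f (g n) : ℕ → ℕ) :=
  (hf.comp hg).of_eq fun n => Part.bind_some (g n) (f : ℕ →. ℕ)

theorem recursiveIn_pair {O : Set (ℕ →. ℕ)} {f g : ℕ → ℕ} (hf : Nat.RecursiveIn O f)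
    (hg : Nat.RecursiveIn O g) : Nat.RecursiveIn O (fun n => Nat.pair (f n) (g n) : ℕ → ℕ) :=
  (hf.pair hg).of_eq fun n => by simp [Seq.seq]

theorem recursiveIn_of_primrec {O : Set (ℕ →. ℕ)} {f : ℕ → ℕ} (hf : Primrec f) :
    Nat.RecursiveIn O f :=
  (Primrec.nat_iff.1 hf).recursiveIn

/-- Primitive recursion relative to `B`: each step decodes the list so far, appends one oracle bit,
and encodes again. -/
theorem recursiveIn_initSeg (B : Cantor) :
    Nat.RecursiveIn {(char B : ℕ →. ℕ)}
      (fun k => Encodable.encode (initSeg B k) : ℕ → ℕ) := by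
  have hstep : Primrec fun p : ℕ => Encodable.encode
      (((Encodable.decode (α := List Bool) p.unpair.2).getD []) ++ [decide (p.unpair.1 = 1)]) := by
    refine Primrec.encode.comp (Primrec.list_concat.comp (Primrec.option_getD.comp
      (Primrec.decode.comp (Primrec.snd.comp Primrec.unpair)) (Primrec.const [])) ?_)
    exact (Primrec.eq.comp (Primrec.fst.comp Primrec.unpair) (Primrec.const 1)).decide
  have hy : Nat.RecursiveIn {(char B : ℕ →. ℕ)}
      (fun p => char B p.unpair.2.unpair.1 : ℕ → ℕ) :=
    recursiveIn_comp (f := char B) (.oracle _ rfl) (recursiveIn_of_primrec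
      (Primrec.fst.comp (Primrec.unpair.comp (Primrec.snd.comp Primrec.unpair))))
  have h := Nat.RecursiveIn.prec (recursiveIn_of_primrec (O := {(char B : ℕ →. ℕ)})
      (Primrec.const (Encodable.encode ([] : List Bool))))
    (recursiveIn_comp (recursiveIn_of_primrec hstep) (recursiveIn_pair hy
      (recursiveIn_of_primrec
        (Primrec.snd.comp (Primrec.unpair.comp (Primrec.snd.comp Primrec.unpair))))))
  refine (h.comp (recursiveIn_pair (recursiveIn_of_primrec (Primrec.const 0))
    (recursiveIn_of_primrec Primrec.id))).of_eq fun k => ?_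
  simp only [PFun.coe_val, Part.bind_eq_bind, Part.bind_some, Nat.unpair_pair, id]
  induction k with
  | zero => simp [initSeg]
  | succ k ih =>
    simp only [ih, Part.bind_some, Encodable.encodek, Option.getD_some]
    have : decide (char B k = 1) = B k := by
      unfold char; cases B k <;> rfl
    rw [this, initSeg, initSeg, List.range_succ, List.map_append, List.map_singleton]

/-- If each value of `A` can be found by an effective search through finite parts of `B`,
then `A ≤_T B`. -/
theorem reducible_of_search {A : ℕ → ℕ} {B : Cantor} {P : List Bool × ℕ × ℕ → Option ℕ}
    (hP : Primrec P) (sound : ∀ k w x v, P (initSeg B k, w, x) = some v → v = A x)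
    (complete : ∀ x, ∃ k w, (P (initSeg B k, w, x)).isSome) : Reducible A (char B) := by
  refine RecursiveIn.iff_nat.2 ?_
  have hQ : Primrec fun p : ℕ => Encodable.encode
      (P ((Encodable.decode (α := List Bool) p.unpair.1).getD [],
        p.unpair.2.unpair.2.unpair.2, p.unpair.2.unpair.1)) := by
    refine Primrec.encode.comp (hP.comp (Primrec.pair (Primrec.option_getD.comp
      (Primrec.decode.comp (Primrec.fst.comp Primrec.unpair)) (Primrec.const [])) ?_))
    have h2 : Primrec fun p : ℕ => p.unpair.2.unpair :=
      Primrec.unpair.comp (Primrec.snd.comp Primrec.unpair)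
    exact Primrec.pair (Primrec.snd.comp (Primrec.unpair.comp (Primrec.snd.comp h2)))
      (Primrec.fst.comp h2)
  have hR := recursiveIn_comp (recursiveIn_of_primrec hQ)
    (recursiveIn_pair (recursiveIn_comp (recursiveIn_initSeg B)
      (recursiveIn_of_primrec (Primrec.fst.comp (Primrec.unpair.comp
        (Primrec.snd.comp Primrec.unpair))))) (recursiveIn_of_primrec Primrec.id))
  simp only [Nat.unpair_pair, Encodable.encodek, Option.getD_some, id] at hR
  set R : ℕ → ℕ := fun n => Encodable.encode
    (P (initSeg B n.unpair.2.unpair.1, n.unpair.2.unpair.2, n.unpair.1)) with hRdef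
  -- `R` is `0` for no answer and `v + 1` for the answer `v`. Thus `1 - R` vanishes exactly where
  -- the search succeeds, and the predecessor of `R` is the answer.
  have hS := Nat.RecursiveIn.rfind (recursiveIn_comp (recursiveIn_of_primrec
    (Primrec.nat_sub.comp (Primrec.const 1) Primrec.id)) hR)
  have hT := (recursiveIn_comp (recursiveIn_of_primrec Primrec.pred) hR).comp
    ((recursiveIn_of_primrec Primrec.id).pair hS)
  refine hT.of_eq_tot fun x => ?_
  obtain ⟨k, w, hkw⟩ := complete x
  have hdom : (Nat.rfind fun n => (fun m => decide (m = 0)) <$>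
      ((fun n => 1 - R n : ℕ → ℕ) : ℕ →. ℕ) (Nat.pair x n)).Dom := by
    refine Nat.rfind_dom'.2 ⟨Nat.pair k w, ?_, fun _ => trivial⟩
    obtain ⟨v, hv⟩ := Option.isSome_iff_exists.1 hkw
    refine (Part.mem_map_iff _).2 ⟨0, ?_, rfl⟩
    simp [hRdef, hv]
  obtain ⟨t, ht⟩ := Part.dom_iff_mem.1 hdom
  have ht' := (Nat.mem_rfind.1 ht).1
  simp only [PFun.coe_val, Part.map_eq_map, Part.map_some, Part.mem_some_iff] at ht'
  have hpos : R (Nat.pair x t) ≠ 0 := by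
    intro h0
    simp [h0] at ht'
  have hval : R (Nat.pair x t) - 1 = A x := by
    simp only [hRdef, Nat.unpair_pair] at hpos ⊢
    rcases hv : P (initSeg B t.unpair.1, t.unpair.2, x) with _ | v
    · simp [hv] at hpos
    · simpa using sound _ _ _ _ hv
  refine Part.mem_bind_iff.2 ⟨Nat.pair x t, ?_, ?_⟩
  · simp only [Seq.seq, PFun.coe_val, Part.map_eq_map, Part.map_some, Part.bind_some,
      Part.mem_map_iff, id]
    exact ⟨t, ht, rfl⟩
  · simp [hval]

/-! ### The universal functional -/

theorem findSome?_congr {α β : Type} {f g : α → Option β} {l : List α}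
    (h : ∀ a ∈ l, f a = g a) : l.findSome? f = l.findSome? g := by
  induction l with
  | nil => rfl
  | cons a l ih =>
    rw [List.findSome?_cons, List.findSome?_cons, h a List.mem_cons_self,
      ih fun b hb => h b (List.mem_cons_of_mem a hb)]

theorem findSome?_range_mono {α : Type} {f : ℕ → Option α} {s t : ℕ} (hst : s ≤ t) {v : α}
    (h : (List.range s).findSome? f = some v) : (List.range t).findSome? f = some v := by
  obtain ⟨d, rfl⟩ := Nat.exists_eq_add_of_le hst
  simp [List.range_add, List.findSome?_append, h]

theorem find?_range_mono {p : ℕ → Bool} {s t : ℕ} (hst : s ≤ t) {v : ℕ}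
    (h : (List.range s).find? p = some v) : (List.range t).find? p = some v := by
  obtain ⟨d, rfl⟩ := Nat.exists_eq_add_of_le hst
  simp only [List.range_add, List.find?_append, h, Option.some_or]

theorem Psi_mono {i : ℕ} {X : Cantor} {n s t v : ℕ} (hst : s ≤ t) (h : Psi i X n s = some v) :
    Psi i X n t = some v :=
  findSome?_range_mono (Nat.succ_le_succ hst) h

theorem rawPhi_mono {X : Cantor} {n s t v : ℕ} (hst : s ≤ t) (h : rawPhi X n s = some v) :
    rawPhi X n t = some v := by
  obtain ⟨i, hi, h⟩ := Option.bind_eq_some_iff.1 h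
  exact Option.bind_eq_some_iff.2
    ⟨i, find?_range_mono (Nat.succ_le_succ hst) hi, Psi_mono hst h⟩

/-- Later arguments use `Φ` only through its convergence; the bound `v ≤ s` is what eventually turns
"converges by stage `f k`" into "has value at most `f k`". -/
theorem Phi_isSome_iff {X : Cantor} {n s : ℕ} :
    (Phi X n s).isSome ↔ ∀ m ≤ n, ∃ v ≤ s, rawPhi X m s = some v := by
  have key : ((List.range (n + 1)).all fun m => (rawPhi X m s).any fun v => decide (v ≤ s)) = true ↔
      ∀ m ≤ n, ∃ v ≤ s, rawPhi X m s = some v := by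
    simp only [List.all_eq_true, List.mem_range, Nat.lt_succ_iff, Option.any_eq_true,
      decide_eq_true_eq]
    exact forall₂_congr fun m _ => exists_congr fun v => and_comm
  unfold Phi
  split_ifs with h
  · refine ⟨fun _ => key.1 h, fun h' => ?_⟩
    obtain ⟨v, -, hv⟩ := h' n le_rfl
    simp [hv]
  · exact ⟨fun h' => by simp at h', fun h' => absurd (key.2 h') h⟩

theorem Phi_isSome_mono {X : Cantor} {m n s t : ℕ} (hmn : m ≤ n) (hst : s ≤ t)
    (h : (Phi X n s).isSome) : (Phi X m t).isSome := by
  rw [Phi_isSome_iff] at h ⊢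
  intro k hk
  obtain ⟨v, hv, h⟩ := h k (hk.trans hmn)
  exact ⟨v, hv.trans hst, rawPhi_mono hst h⟩

theorem exists_Phi_isSome {X : Cantor} (h : ∀ n, ∃ s v, rawPhi X n s = some v) (n : ℕ) :
    ∃ s, (Phi X n s).isSome := by
  choose s v hsv using h
  refine ⟨(Finset.range (n + 1)).sup fun m => max (s m) (v m), Phi_isSome_iff.2 fun m hm => ?_⟩
  have := Finset.le_sup (f := fun m => max (s m) (v m))
    (Finset.mem_range.2 (Nat.lt_succ_of_le hm))
  exact ⟨v m, (le_max_right _ _).trans this, rawPhi_mono ((le_max_left _ _).trans this) (hsv m)⟩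

/-- `Psi` returns the first answer found, possibly from another initial segment than the one known
to give `g n`. Monotonicity of the functional makes all answers along `X` agree. -/
theorem Reducible.exists_Psi {g : ℕ → ℕ} {X : Cantor} (H : Reducible g (char X)) :
    ∃ i, ∀ n, ∃ s, Psi i X n s = some (g n) := by
  obtain ⟨F, pF, mF, cF⟩ := H.exists_functional
  have hseg : ∀ k, initSeg (char X) k = (initSeg X k).map Bool.toNat := fun k => by
    simp [initSeg, char, Function.comp_def]
  have hc : Partrec fun a : List Bool × ℕ => F (a.1.map Bool.toNat) a.2 :=
    pF.comp (Primrec.list_map Primrec.fst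
      ((Primrec.dom_finite Bool.toNat).comp Primrec.snd).to₂).to_comp Computable.snd
  obtain ⟨c, hc⟩ := Nat.Partrec.Code.exists_code.1 hc
  have heval : ∀ k n v, v ∈ c.eval (Encodable.encode (initSeg X k, n)) ↔
      v ∈ F (initSeg (char X) k) n := fun k n v => by
    rw [hc, hseg]
    simp
  refine ⟨Encodable.encode c, fun n => ?_⟩
  obtain ⟨k, hk⟩ := cF n
  obtain ⟨u, hu⟩ := Nat.Partrec.Code.evaln_complete.1 ((heval _ _ _).2 hk)
  refine ⟨Nat.pair k u, ?_⟩
  have hsome : (Psi (Encodable.encode c) X n (Nat.pair k u)).isSome := by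
    unfold Psi
    rw [List.findSome?_isSome_iff]
    refine ⟨Nat.pair k u, by simp, ?_⟩
    rw [Denumerable.ofNat_encode, Nat.unpair_pair]
    exact Option.isSome_iff_exists.2 ⟨_, hu⟩
  obtain ⟨w, hw⟩ := Option.isSome_iff_exists.1 hsome
  obtain ⟨t, -, ht⟩ := List.exists_of_findSome?_eq_some hw
  rw [Denumerable.ofNat_encode] at ht
  rw [hw, mF.unique ((heval _ _ _).1 (Nat.Partrec.Code.evaln_sound ht)) hk]

theorem join_two_mul {α : Type} (x y : ℕ → α) (n : ℕ) : join x y (2 * n) = x n := by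
  simp [join]

theorem join_two_mul_add_one {α : Type} (x y : ℕ → α) (n : ℕ) : join x y (2 * n + 1) = y n := by
  have h1 : (2 * n + 1) % 2 = 1 := by omega
  have h2 : (2 * n + 1) / 2 = n := by omega
  simp [join, h1, h2]

theorem rawPhi_join {B W : Cantor} {i : ℕ} (h0 : ∀ j < i, W j = false) (h1 : W i = true)
    {n s : ℕ} (hs : i ≤ s) :
    rawPhi (join B W) n s = Psi i (join B fun j => W (i + 1 + j)) n s := by
  have : (List.range (s + 1)).find? (fun j => join B W (2 * j + 1)) = some i := by
    refine find?_range_mono (Nat.succ_le_succ hs) ?_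
    rw [List.range_succ, List.find?_append, List.find?_eq_none.2]
    · simp [join_two_mul_add_one, h1]
    · intro j hj
      simp [join_two_mul_add_one, h0 j (List.mem_range.1 hj)]
  unfold rawPhi
  rw [this]
  simp only [Option.bind_some, join_two_mul, join_two_mul_add_one]

theorem Psi_congr {i : ℕ} {X Y : Cantor} {n s : ℕ} (h : ∀ j < s, X j = Y j) :
    Psi i X n s = Psi i Y n s := by
  refine findSome?_congr fun t ht => ?_
  have : (List.range t.unpair.1).map X = (List.range t.unpair.1).map Y :=
    List.map_congr_left fun j hj => h j ((List.mem_range.1 hj).trans_le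
      ((Nat.unpair_left_le t).trans (Nat.lt_succ_iff.1 (List.mem_range.1 ht))))
  rw [this]

/-- At stage `s` the index satisfies `i ≤ s` and `Psi` reads fewer than `s` bits of the decoded
oracle, so the positions read in `X` are at most `3s + 2`. -/
theorem rawPhi_congr {X Y : Cantor} {n s : ℕ} (h : ∀ j < 4 * s + 4, X j = Y j) :
    rawPhi X n s = rawPhi Y n s := by
  unfold rawPhi
  have : (List.range (s + 1)).find? (fun i => X (2 * i + 1)) =
      (List.range (s + 1)).find? fun i => Y (2 * i + 1) :=
    List.find?_congr fun i hi => h _ (by have := List.mem_range.1 hi; omega)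
  rw [this]
  refine Option.bind_congr fun i hi => Psi_congr fun j hj => ?_
  have := List.mem_range.1 (List.mem_of_find?_eq_some hi)
  unfold join
  dsimp only
  split_ifs
  · exact h _ (by omega)
  · exact h _ (by omega)

theorem Phi_congr {X Y : Cantor} {n s : ℕ} (h : ∀ j < 4 * s + 4, X j = Y j) :
    Phi X n s = Phi Y n s := by
  unfold Phi
  simp only [rawPhi_congr h]

/-! ### Effectivity of the universal functional -/

section Effectivity

variable {α : Type} [Primcodable α]

theorem primrec_findSome? {β σ : Type} [Primcodable β] [Primcodable σ] {l : α → List β}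
    {f : α → β → Option σ} (hl : Primrec l) (hf : Primrec₂ f) :
    Primrec fun a => (l a).findSome? (f a) :=
  (Primrec.list_head?.comp (Primrec.listFilterMap hl hf)).of_eq fun a => by
    rw [List.head?_filterMap]

theorem primrec_find? {β : Type} [Primcodable β] {l : α → List β} {p : α → β → Bool}
    (hl : Primrec l) (hp : Primrec₂ p) : Primrec fun a => (l a).find? (p a) := by
  refine (primrec_findSome? (f := fun a b => bif p a b then some b else none) hl
    (Primrec.cond hp (Primrec.option_some.comp Primrec.snd) (Primrec.const none))).of_eq
    fun a => ?_
  rw [List.find?_eq_findSome?_guard]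
  refine findSome?_congr fun b _ => ?_
  simp [Option.guard, cond_eq_ite]

theorem primrec_all {β : Type} [Primcodable β] {l : α → List β} {p : α → β → Bool}
    (hl : Primrec l) (hp : Primrec₂ p) : Primrec fun a => (l a).all (p a) := by
  refine (Primrec.not.comp (Primrec.option_isSome.comp
    (primrec_find? (p := fun a b => !p a b) hl (Primrec.not.comp hp)))).of_eq fun a => ?_
  rw [Bool.eq_iff_iff]
  simp

theorem primrec_join {σ : Type} [Primcodable σ] {X Y : α → ℕ → σ} (hX : Primrec₂ X)
    (hY : Primrec₂ Y) : Primrec₂ fun a => join (X a) (Y a) :=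
  have half : Primrec fun p : α × ℕ => p.2 / 2 :=
    Primrec.nat_div.comp Primrec.snd (Primrec.const 2)
  Primrec.ite (Primrec.eq.comp (Primrec.nat_mod.comp Primrec.snd (Primrec.const 2))
    (Primrec.const 0)) (hX.comp Primrec.fst half) (hY.comp Primrec.fst half)

theorem primrec_Psi {i n s : α → ℕ} {X : α → Cantor} (hi : Primrec i) (hX : Primrec₂ X)
    (hn : Primrec n) (hs : Primrec s) : Primrec fun a => Psi (i a) (X a) (n a) (s a) := by
  refine primrec_findSome? (Primrec.list_range.comp (Primrec.succ.comp hs))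
    (f := fun a t => Nat.Partrec.Code.evaln t.unpair.2
      (Denumerable.ofNat Nat.Partrec.Code (i a))
      (Encodable.encode ((List.range t.unpair.1).map (X a), n a))) ?_
  have ht : Primrec fun p : α × ℕ => p.2.unpair := Primrec.unpair.comp Primrec.snd
  refine Nat.Partrec.Code.primrec_evaln.comp (Primrec.pair (Primrec.pair
    (Primrec.snd.comp ht) ((Primrec.ofNat _).comp (hi.comp Primrec.fst)))
    (Primrec.encode.comp (Primrec.pair ?_ (hn.comp Primrec.fst))))
  exact Primrec.list_map (Primrec.list_range.comp (Primrec.fst.comp ht))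
    (hX.comp (Primrec.fst.comp Primrec.fst) Primrec.snd)

theorem primrec_rawPhi {n s : α → ℕ} {X : α → Cantor} (hX : Primrec₂ X)
    (hn : Primrec n) (hs : Primrec s) : Primrec fun a => rawPhi (X a) (n a) (s a) := by
  have hodd : Primrec fun j : ℕ => 2 * j + 1 :=
    Primrec.succ.comp (Primrec.nat_mul.comp (Primrec.const 2) Primrec.id)
  refine Primrec.option_bind (primrec_find? (Primrec.list_range.comp (Primrec.succ.comp hs))
    (hX.comp Primrec.fst (hodd.comp Primrec.snd))) (primrec_Psi (α := α × ℕ)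
    Primrec.snd (primrec_join ?_ ?_) (hn.comp Primrec.fst) (hs.comp Primrec.fst))
  · exact hX.comp (Primrec.fst.comp Primrec.fst)
      (Primrec.nat_mul.comp (Primrec.const 2) Primrec.snd)
  · exact hX.comp (Primrec.fst.comp Primrec.fst) (hodd.comp (Primrec.nat_add.comp
      (Primrec.succ.comp (Primrec.snd.comp Primrec.fst)) Primrec.snd))

theorem primrec_Phi {n s : α → ℕ} {X : α → Cantor} (hX : Primrec₂ X)
    (hn : Primrec n) (hs : Primrec s) : Primrec fun a => Phi (X a) (n a) (s a) := by
  refine Primrec.ite (PrimrecPred.of_eq (p := fun a => ((List.range (n a + 1)).all fun m =>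
    (rawPhi (X a) m (s a)).any fun v => decide (v ≤ s a)) = true) ?_ fun a => Iff.rfl)
    (primrec_rawPhi hX hn hs) (Primrec.const none)
  refine Primrec.eq.comp (primrec_all (Primrec.list_range.comp (Primrec.succ.comp hn)) ?_)
    (Primrec.const true)
  have hraw : Primrec fun p : α × ℕ => rawPhi (X p.1) p.2 (s p.1) :=
    primrec_rawPhi (hX.comp (Primrec.fst.comp Primrec.fst) Primrec.snd) Primrec.snd
      (hs.comp Primrec.fst)
  have hle : Primrec₂ fun (p : α × ℕ) (v : ℕ) => decide (v ≤ s p.1) :=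
    (Primrec.nat_le.comp Primrec.snd (hs.comp (Primrec.fst.comp Primrec.fst))).decide
  refine (Primrec.option_getD.comp (Primrec.option_map hraw hle) (Primrec.const false)).of_eq
    fun p => ?_
  dsimp only
  cases rawPhi (X p.1) p.2 (s p.1) <;> rfl

end Effectivity

/-! ### Fair-coin measure -/

theorem measurableSet_of_bits {p : Cantor → Prop} (m : ℕ)
    (h : ∀ X Y : Cantor, (∀ j < m, X j = Y j) → (p X ↔ p Y)) : MeasurableSet {X | p X} := by
  have hr : Measurable fun (X : Cantor) (j : Fin m) => X j :=
    measurable_pi_lambda _ fun j => measurable_pi_apply _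
  have : {X | p X} = (fun (X : Cantor) (j : Fin m) => X j) ⁻¹'
      {x | p fun j => if hj : j < m then x ⟨j, hj⟩ else false} := by
    ext X
    exact h _ _ fun j hj => by simp [hj]
  rw [this]
  exact hr (Set.toFinite _).measurableSet

theorem coinMeasure_pi (s : Finset ℕ) (t : ℕ → Set Bool) :
    coinMeasure (Set.pi s t) = ∏ i ∈ s, (PMF.uniformOfFintype Bool).toMeasure (t i) :=
  Measure.infinitePi_pi _ fun _ _ => MeasurableSet.of_discrete

theorem coinMeasure_real_cylinder (m : ℕ) (X : Cantor) :
    coinMeasure.real {Z | ∀ j < m, Z j = X j} = 2⁻¹ ^ m := by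
  have : {Z : Cantor | ∀ j < m, Z j = X j} = Set.pi (Finset.range m) fun j => {X j} := by
    ext Z
    simp [Set.mem_pi]
  rw [this, Measure.real, coinMeasure_pi]
  simp

/-- The binary digits of the numbers below `2 ^ m` run through all strings of length `m`. This turns
measures of clopen sets into a primitive recursive count. -/
theorem coinMeasure_real_eq_count {p : Cantor → Prop} {m : ℕ}
    (h : ∀ X Y : Cantor, (∀ j < m, X j = Y j) → (p X ↔ p Y))
    [DecidablePred fun t : ℕ => p t.testBit] :
    coinMeasure.real {X | p X} = Nat.count (fun t => p t.testBit) (2 ^ m) * 2⁻¹ ^ m := by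
  have hU : {X | p X} = ⋃ t ∈ (Finset.range (2 ^ m)).filter fun t => p t.testBit,
      {Z : Cantor | ∀ j < m, Z j = t.testBit j} := by
    ext X
    simp only [Set.mem_iUnion, Finset.mem_filter, Finset.mem_range, Set.mem_ofPred_eq, exists_prop]
    constructor
    · intro hX
      have hbit : ∀ j < m, X j = (Nat.ofBits fun i : Fin m => X i).testBit j := fun j hj =>
        (Nat.testBit_ofBits_lt (fun i : Fin m => X i) j hj).symm
      exact ⟨_, ⟨Nat.ofBits_lt_two_pow _, (h _ _ hbit).1 hX⟩, hbit⟩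
    · rintro ⟨t, ⟨-, ht⟩, hX⟩
      exact (h _ _ hX).2 ht
  rw [hU, measureReal_biUnion_finset]
  · simp only [coinMeasure_real_cylinder, Finset.sum_const, nsmul_eq_mul,
      Nat.count_eq_card_filter_range]
  · intro t ht u hu htu
    refine Set.disjoint_left.2 fun Z hZ hZ' => htu (Nat.eq_of_testBit_eq fun j => ?_)
    simp only [Finset.coe_filter, Finset.mem_range, Set.mem_ofPred_eq] at ht hu
    by_cases hj : j < m
    · rw [← hZ j hj, hZ' j hj]
    · have hle : 2 ^ m ≤ 2 ^ j := Nat.pow_le_pow_right two_pos (not_lt.1 hj)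
      rw [Nat.testBit_lt_two_pow (ht.1.trans_le hle), Nat.testBit_lt_two_pow (hu.1.trans_le hle)]
  · exact fun t _ => measurableSet_of_bits m fun X Y hXY =>
      forall₂_congr fun j hj => by rw [hXY j hj]

theorem exists_measureReal_lt {S : ℕ → Set Cantor} (hS : Antitone S)
    (hm : ∀ n, MeasurableSet (S n)) (hI : ⋂ n, S n = ∅) {ε : ℝ} (hε : 0 < ε) :
    ∃ n, coinMeasure.real (S n) < ε := by
  have h := tendsto_measure_iInter_atTop (μ := coinMeasure)
    (fun n => (hm n).nullMeasurableSet) hS ⟨0, measure_ne_top _ _⟩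
  rw [hI, measure_empty] at h
  have h' := (ENNReal.tendsto_toReal ENNReal.zero_ne_top).comp h
  exact (h'.eventually (gt_mem_nhds (by simpa using hε))).exists

/-- The sequence `b Z`. -/
def consBit (b : Bool) (Z : Cantor) : Cantor := fun n => Nat.casesOn n b Z

@[simp] theorem consBit_succ (b : Bool) (Z : Cantor) (n : ℕ) : consBit b Z (n + 1) = Z n := rfl

theorem measurable_consBit (b : Bool) : Measurable (consBit b) := by
  refine measurable_pi_lambda _ fun n => ?_
  cases n with
  | zero => exact measurable_const
  | succ n => exact measurable_pi_apply n

/-- The first bit is fair and independent of the tail. It suffices to compare both measures on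
rectangles. -/
theorem map_consBit_false_add_true :
    (2⁻¹ : ENNReal) • (coinMeasure.map (consBit false) + coinMeasure.map (consBit true)) =
      coinMeasure := by
  refine Measure.eq_infinitePi _ fun s t ht => ?_
  -- Padding with full factors makes the index set an initial segment containing `0`, so that the
  -- factor of the first bit can be split off.
  set u : ℕ → Set Bool := fun i => if i ∈ s then t i else Set.univ with hu
  obtain ⟨n, hn⟩ : ∃ n, s ⊆ Finset.range (n + 1) := by
    obtain ⟨n, hn⟩ := s.exists_nat_subset_range
    exact ⟨n, hn.trans (Finset.range_mono n.le_succ)⟩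
  have hset : Set.pi (s : Set ℕ) t = Set.pi (Finset.range (n + 1)) u := by
    ext Z
    simp only [Set.mem_pi, Finset.mem_coe, hu]
    refine ⟨fun h i _ => ?_, fun h i hi => ?_⟩
    · split_ifs with hi
      exacts [h i hi, Set.mem_univ _]
    · simpa [hi] using h i (hn hi)
  have hprod : ∏ i ∈ s, (PMF.uniformOfFintype Bool).toMeasure (t i) =
      ∏ i ∈ Finset.range (n + 1), (PMF.uniformOfFintype Bool).toMeasure (u i) := by
    rw [← Finset.prod_subset hn fun i _ hi => by
      rw [show u i = Set.univ from if_neg hi, measure_univ]]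
    exact Finset.prod_congr rfl fun i hi => by simp [hu, hi]
  have hpre : ∀ b, coinMeasure.map (consBit b) (Set.pi (Finset.range (n + 1)) u) =
      (u 0).indicator 1 b *
        ∏ i ∈ Finset.range n, (PMF.uniformOfFintype Bool).toMeasure (u (i + 1)) := by
    intro b
    rw [Measure.map_apply (measurable_consBit b)
      (MeasurableSet.pi (Finset.countable_toSet _) fun _ _ => MeasurableSet.of_discrete)]
    by_cases hb : b ∈ u 0
    · rw [Set.indicator_of_mem hb, Pi.one_apply, one_mul,
        ← coinMeasure_pi (Finset.range n) fun i => u (i + 1)]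
      congr 1
      ext Z
      simp only [Set.mem_preimage, Set.mem_pi, Finset.coe_range, Set.mem_Iio]
      refine ⟨fun h i hi => h (i + 1) (Nat.succ_lt_succ hi), fun h i hi => ?_⟩
      cases i with
      | zero => exact hb
      | succ i => exact h i (Nat.succ_lt_succ_iff.1 hi)
    · rw [Set.indicator_of_notMem hb, zero_mul]
      refine measure_mono_null (fun Z hZ => hb ?_) measure_empty
      exact hZ 0 (by simp)
  have hu0 : (PMF.uniformOfFintype Bool).toMeasure (u 0) =
      2⁻¹ * ((u 0).indicator 1 false + (u 0).indicator 1 true) := by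
    rw [PMF.toMeasure_apply_fintype, Fintype.sum_bool]
    by_cases h1 : true ∈ u 0 <;> by_cases h2 : false ∈ u 0 <;> simp [h1, h2, mul_add]
  rw [hset, hprod, Finset.prod_range_succ', hu0, Measure.smul_apply, Measure.add_apply, hpre,
    hpre, ← add_mul, smul_eq_mul]
  ring

/-- Half of the image measure is a summand of `coinMeasure`, so null sets have null preimages. -/
theorem quasiMeasurePreserving_consBit (b : Bool) :
    Measure.QuasiMeasurePreserving (consBit b) coinMeasure coinMeasure := by
  refine ⟨measurable_consBit b, Measure.AbsolutelyContinuous.mk fun s _ h0 => ?_⟩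
  rw [← map_consBit_false_add_true, Measure.smul_apply, Measure.add_apply, smul_eq_mul,
    mul_eq_zero, add_eq_zero] at h0
  have h := h0.resolve_left (by simp)
  cases b
  exacts [h.1, h.2]

/-- The sequence `0^i 1 Z`. -/
def codeIndex (i : ℕ) (Z : Cantor) : Cantor := (consBit false)^[i] (consBit true Z)

theorem codeIndex_succ (i : ℕ) (Z : Cantor) :
    codeIndex (i + 1) Z = consBit false (codeIndex i Z) :=
  Function.iterate_succ_apply' _ _ _

theorem codeIndex_of_lt {i j : ℕ} (Z : Cantor) (h : j < i) : codeIndex i Z j = false := by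
  induction i generalizing j with
  | zero => exact absurd h j.not_lt_zero
  | succ i ih =>
    rw [codeIndex_succ]
    cases j with
    | zero => rfl
    | succ j => exact ih (Nat.succ_lt_succ_iff.1 h)

theorem codeIndex_self (i : ℕ) (Z : Cantor) : codeIndex i Z i = true := by
  induction i with
  | zero => rfl
  | succ i ih => rw [codeIndex_succ, consBit_succ, ih]

theorem codeIndex_add (i : ℕ) (Z : Cantor) (j : ℕ) : codeIndex i Z (i + 1 + j) = Z j := by
  induction i with
  | zero => rw [zero_add, add_comm]; rfl
  | succ i ih => rw [codeIndex_succ, show i + 1 + 1 + j = (i + 1 + j) + 1 by omega, consBit_succ, ih]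

theorem ae_codeIndex {p : Cantor → Prop} (h : ∀ᵐ W ∂coinMeasure, p W) (i : ℕ) :
    ∀ᵐ Z ∂coinMeasure, p (codeIndex i Z) := by
  induction i generalizing p with
  | zero => exact (quasiMeasurePreserving_consBit true).ae h
  | succ i ih =>
    simp only [codeIndex_succ]
    exact ih ((quasiMeasurePreserving_consBit false).ae h)

/-! ### Stages of the domain of the universal functional -/

/-- The set of all `Z` such that `Φ(B ⊕ Z; n)↓[s]`. -/
def stage (B : Cantor) (n s : ℕ) : Set Cantor := {Z | (Phi (join B Z) n s).isSome}

theorem Phi_join_congr {B B' Z Z' : Cantor} {n s : ℕ} (hB : ∀ j < 4 * s + 4, B j = B' j)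
    (hZ : ∀ j < 4 * s + 4, Z j = Z' j) : Phi (join B Z) n s = Phi (join B' Z') n s := by
  refine Phi_congr fun j hj => ?_
  unfold join
  split_ifs
  · exact hB _ (by omega)
  · exact hZ _ (by omega)

theorem measurableSet_stage (B : Cantor) (n s : ℕ) : MeasurableSet (stage B n s) :=
  measurableSet_of_bits (p := fun Z => (Phi (join B Z) n s).isSome = true) (4 * s + 4)
    fun X Y h => by rw [Phi_join_congr (fun _ _ => rfl) h]

theorem stage_subset {B : Cantor} {m n s t : ℕ} (hmn : m ≤ n) (hst : s ≤ t) :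
    stage B n s ⊆ stage B m t :=
  fun _ h => Phi_isSome_mono hmn hst h

theorem domPhi_eq (B : Cantor) : domPhi B = ⋂ n, ⋃ s, stage B n s := by
  ext Z
  simp [domPhi, stage]

theorem measurableSet_domPhi (B : Cantor) : MeasurableSet (domPhi B) := by
  rw [domPhi_eq]
  exact .iInter fun n => .iUnion fun s => measurableSet_stage B n s

theorem exists_domPhi_diff_stage_lt (B : Cantor) (n : ℕ) {ε : ℝ} (hε : 0 < ε) :
    ∃ s, coinMeasure.real (domPhi B \ stage B n s) < ε := by
  refine exists_measureReal_lt (fun s t hst => Set.sdiff_subset_sdiff_right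
    (stage_subset le_rfl hst)) (fun s => (measurableSet_domPhi B).diff (measurableSet_stage B n s))
    (Set.eq_empty_iff_forall_notMem.2 fun Z hZ => ?_) hε
  rw [Set.mem_iInter] at hZ
  obtain ⟨s, hs⟩ := (hZ 0).1 n
  exact (hZ s).2 hs

/-- `domPhi B` is a decreasing intersection over `n` of increasing unions over `s`. Choosing `n`
approximates it from outside; then `s` approximates the union from inside. The result is a clopen
substitute for `domPhi B`. -/
theorem exists_stage_approx (B : Cantor) {ε : ℝ} (hε : 0 < ε) :
    ∃ n s, coinMeasure.real (domPhi B \ stage B n s) < ε ∧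
      coinMeasure.real (stage B n s \ domPhi B) < ε := by
  obtain ⟨n, hn⟩ : ∃ n, coinMeasure.real ((⋃ s, stage B n s) \ domPhi B) < ε := by
    refine exists_measureReal_lt (S := fun n => (⋃ s, stage B n s) \ domPhi B)
      (fun m n hmn => Set.sdiff_subset_sdiff_left
      (Set.iUnion_mono fun s => stage_subset hmn le_rfl))
      (fun n => (MeasurableSet.iUnion fun s => measurableSet_stage B n s).diff
        (measurableSet_domPhi B)) (Set.eq_empty_iff_forall_notMem.2 fun Z hZ => ?_) hε
    rw [Set.mem_iInter] at hZ
    refine (hZ 0).2 ?_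
    rw [domPhi_eq, Set.mem_iInter]
    exact fun n => (hZ n).1
  obtain ⟨s, hs⟩ := exists_domPhi_diff_stage_lt B n hε
  exact ⟨n, s, hs, (measureReal_mono (Set.sdiff_subset_sdiff_left
    (Set.subset_iUnion _ s))).trans_lt hn⟩

/-! ### Generic functions -/

theorem mem_boundedBy {B : Cantor} {n : ℕ} {g : List ℕ} {Z : Cantor} :
    Z ∈ boundedBy B n g ↔ ∀ k < g.length, n ≤ k → Z ∈ stage B k (g.getD k 0) := by
  refine forall₂_congr fun k hk => ?_
  rw [List.getD_eq_getElem _ _ hk]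
  rfl

/-- The conditions with stem of length greater than `n`. -/
def longStem (B : Cantor) (n : ℕ) : Set (Condition B) := {q | n < q.stem.length}

/-- The conditions `⟨f, ε⟩` with `ε < 1 / (n + 1)`. -/
def smallEps (B : Cantor) (n : ℕ) : Set (Condition B) := {q | (q.eps : ℝ) < 1 / (n + 1)}

theorem exists_extends_length_succ {B : Cantor} (p : Condition B) :
    ∃ q ≤ p, q.stem.length = p.stem.length + 1 := by
  have hε : (0 : ℝ) < p.eps / 2 := half_pos (by exact_mod_cast p.eps_pos)
  -- Half of `ε` pays for the new value `s`; the other half remains as the new bound.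
  obtain ⟨s, hs⟩ := exists_domPhi_diff_stage_lt B p.stem.length hε
  refine ⟨⟨p.stem ++ [s], p.eps / 2, half_pos p.eps_pos⟩,
    ⟨List.prefix_append _ _, (half_lt_self p.eps_pos).le, fun _ => ?_⟩, by simp⟩
  have : domPhi B \ boundedBy B p.stem.length (p.stem ++ [s]) ⊆
      domPhi B \ stage B p.stem.length s := by
    refine Set.sdiff_subset_sdiff_right fun Z hZ => mem_boundedBy.2 fun k hk hk' => ?_
    obtain rfl : k = p.stem.length := le_antisymm (by simpa [Nat.lt_succ_iff] using hk) hk'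
    simpa using hZ
  have := (measureReal_mono (μ := coinMeasure) this).trans_lt hs
  push_cast
  linarith

theorem forcingDense_longStem (B : Cantor) (n : ℕ) : ForcingDense (longStem B n) := by
  intro p
  induction n with
  | zero =>
    obtain ⟨q, hq, hl⟩ := exists_extends_length_succ p
    exact ⟨q, show 0 < q.stem.length by omega, hq⟩
  | succ n ih =>
    obtain ⟨r, hr, hrp⟩ := ih
    obtain ⟨q, hq, hl⟩ := exists_extends_length_succ r
    have hr : n < r.stem.length := hr
    exact ⟨q, show n + 1 < q.stem.length by omega, hq.trans hrp⟩

theorem extends_of_eps_le {B : Cantor} (p : Condition B) {ε : ℚ} (h0 : 0 < ε) (h : ε ≤ p.eps) :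
    (⟨p.stem, ε, h0⟩ : Condition B) ≤ p :=
  ⟨List.prefix_refl _, h, fun hne => absurd rfl hne⟩

theorem forcingDense_smallEps (B : Cantor) (n : ℕ) : ForcingDense (smallEps B n) := by
  intro p
  have h0 : (0 : ℚ) < min p.eps (1 / (n + 2)) := lt_min p.eps_pos (by positivity)
  refine ⟨⟨p.stem, _, h0⟩, ?_, extends_of_eps_le p h0 (min_le_left _ _)⟩
  have h1 : ((min p.eps (1 / (n + 2)) : ℚ) : ℝ) ≤ 1 / (n + 2) := by
    refine (Rat.cast_le.2 (min_le_right p.eps (1 / ((n : ℚ) + 2)))).trans_eq ?_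
    push_cast
    rfl
  exact h1.trans_lt (one_div_lt_one_div_of_lt (by positivity) (by linarith))

section GenericFunction

variable {B : Cantor} {G : Order.PFilter (Condition B)}

theorem exists_common_extension {p q : Condition B} (hp : p ∈ G) (hq : q ∈ G) :
    ∃ r ∈ G, r ≤ p ∧ r ≤ q :=
  G.directed p hp q hq

theorem getElem?_of_extends {p q : Condition B} (h : q ≤ p) {n m : ℕ}
    (hn : p.stem[n]? = some m) : q.stem[n]? = some m := by
  obtain ⟨ρ, hρ⟩ := h.1
  rw [← hρ, List.getElem?_append_left (List.getElem?_eq_some_iff.1 hn).1, hn]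

theorem exists_isGenericFunction (h : ∀ n, ∃ p ∈ longStem B n, p ∈ G) :
    ∃ f, IsGenericFunction G f := by
  choose p hp hpG using h
  refine ⟨fun n => (p n).stem[n]'(hp n), fun n m => ⟨?_, ?_⟩⟩
  · rintro rfl
    exact ⟨p n, hpG n, List.getElem?_eq_getElem (hp n)⟩
  · rintro ⟨q, hq, hm⟩
    obtain ⟨r, -, hrp, hrq⟩ := exists_common_extension (hpG n) hq
    have h1 := getElem?_of_extends hrp (List.getElem?_eq_getElem (hp n))
    exact Option.some_injective _ (h1.symm.trans (getElem?_of_extends hrq hm))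

theorem IsGenericFunction.stem_eq {f : ℕ → ℕ} (hf : IsGenericFunction G f) {p : Condition B}
    (hp : p ∈ G) : p.stem = initSeg f p.stem.length := by
  refine List.ext_getElem? fun n => ?_
  by_cases hn : n < p.stem.length
  · rw [initSeg_getElem? f hn, List.getElem?_eq_getElem hn, (hf n _).2
      ⟨p, hp, List.getElem?_eq_getElem hn⟩]
  · rw [List.getElem?_eq_none (not_lt.1 hn), List.getElem?_eq_none (by simpa [initSeg] using hn)]

theorem exists_extension_longStem (h : ∀ n, ∃ p ∈ longStem B n, p ∈ G) {p : Condition B}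
    (hp : p ∈ G) (n : ℕ) : ∃ q ∈ G, q ≤ p ∧ n < q.stem.length := by
  obtain ⟨r, hr, hrG⟩ := h n
  obtain ⟨q, hq, hqp, hqr⟩ := exists_common_extension hp hrG
  exact ⟨q, hq, hqp, lt_of_lt_of_le hr hqr.1.length_le⟩

/-- Failures below a given length are controlled by a single extension of `p` in `G` with a longer
stem, whose cost is below `p.eps`. The bound passes to the increasing union over all lengths. -/
theorem IsGenericFunction.measure_not_bounded_le {f : ℕ → ℕ} (hf : IsGenericFunction G f)
    (h : ∀ n, ∃ p ∈ longStem B n, p ∈ G) {p : Condition B} (hp : p ∈ G) :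
    coinMeasure {Z | Z ∈ domPhi B ∧ ∃ k, p.stem.length ≤ k ∧ Z ∉ stage B k (f k)} ≤
      ENNReal.ofReal p.eps := by
  set S : ℕ → Set Cantor := fun l =>
    {Z | Z ∈ domPhi B ∧ ∃ k < l, p.stem.length ≤ k ∧ Z ∉ stage B k (f k)} with hS
  have hU : {Z | Z ∈ domPhi B ∧ ∃ k, p.stem.length ≤ k ∧ Z ∉ stage B k (f k)} = ⋃ l, S l := by
    ext Z
    simp only [hS, Set.mem_iUnion, Set.mem_ofPred_eq]
    constructor
    · rintro ⟨hZ, k, hk⟩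
      exact ⟨k + 1, hZ, k, k.lt_succ_self, hk⟩
    · rintro ⟨l, hZ, k, -, hk⟩
      exact ⟨hZ, k, hk⟩
  have hmono : Monotone S := fun l l' hl Z hZ =>
    ⟨hZ.1, let ⟨k, hk, hk'⟩ := hZ.2; ⟨k, hk.trans_le hl, hk'⟩⟩
  rw [hU, hmono.measure_iUnion]
  refine iSup_le fun l => ?_
  obtain ⟨q, hq, hqp, hlen⟩ := exists_extension_longStem h hp (max l p.stem.length)
  have hne : p.stem ≠ q.stem := fun e => by
    rw [e] at hlen
    exact absurd hlen (not_lt.2 (le_max_right _ _))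
  have hsub : S l ⊆ domPhi B \ boundedBy B p.stem.length q.stem := by
    rintro Z ⟨hZ, k, hkl, hk, hkf⟩
    refine ⟨hZ, fun hb => hkf ?_⟩
    have hkq : k < q.stem.length := hkl.trans ((le_max_left _ _).trans_lt hlen)
    have := mem_boundedBy.1 hb k hkq hk
    rwa [hf.stem_eq hq, initSeg_getD f 0 hkq] at this
  refine (measure_mono hsub).trans ?_
  rw [← ofReal_measureReal]
  have h0 : (0 : ℝ) < q.eps := by exact_mod_cast q.eps_pos
  exact ENNReal.ofReal_le_ofReal (by linarith [hqp.2.2 hne])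

theorem IsGenericFunction.ae_eventually_mem_stage {f : ℕ → ℕ} (hf : IsGenericFunction G f)
    (h : ∀ n, ∃ p ∈ longStem B n, p ∈ G) (h' : ∀ n, ∃ p ∈ smallEps B n, p ∈ G) :
    ∀ᵐ W ∂coinMeasure, W ∈ domPhi B → ∀ᶠ k in atTop, W ∈ stage B k (f k) := by
  rw [ae_iff]
  refine le_antisymm (ENNReal.le_of_forall_pos_le_add fun ε hε _ => ?_) zero_le
  obtain ⟨n, hn⟩ := exists_nat_one_div_lt (show (0 : ℝ) < ε from hε)
  obtain ⟨p, hp, hpG⟩ := h' n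
  rw [zero_add]
  calc _ ≤ coinMeasure {Z | Z ∈ domPhi B ∧ ∃ k, p.stem.length ≤ k ∧ Z ∉ stage B k (f k)} := by
        refine measure_mono fun Z hZ => ?_
        obtain ⟨hZ, hev⟩ := Classical.not_imp.1 hZ
        obtain ⟨k, hk, hk'⟩ := frequently_atTop.1 (not_eventually.1 hev) p.stem.length
        exact ⟨hZ, k, hk, hk'⟩
    _ ≤ ENNReal.ofReal p.eps := hf.measure_not_bounded_le h hpG
    _ ≤ ENNReal.ofReal ε := ENNReal.ofReal_le_ofReal (lt_trans hp hn).le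
    _ = ε := ENNReal.ofReal_coe_nnreal

end GenericFunction

theorem rawPhi_codeIndex {B Z : Cantor} {i n s : ℕ} (hs : i ≤ s) :
    rawPhi (join B (codeIndex i Z)) n s = Psi i (join B Z) n s := by
  rw [rawPhi_join (fun j hj => codeIndex_of_lt Z hj) (codeIndex_self i Z) hs]
  simp only [codeIndex_add]

/-- If `Ψ_i(B ⊕ Z) = g`, then `0^i 1 Z` lies in `domPhi B` and `Φ` has value `g k` there, hence `g k
≤ f k` whenever it converges by stage `f k`. Countably many indices leave one null set. -/
theorem uniformlyAEDominatingOver_of_stage {B : Cantor} {f : ℕ → ℕ}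
    (h : ∀ᵐ W ∂coinMeasure, W ∈ domPhi B → ∀ᶠ k in atTop, W ∈ stage B k (f k)) :
    UniformlyAEDominatingOver B f := by
  filter_upwards [ae_all_iff.2 fun i => ae_codeIndex h i] with Z hZ g hg
  obtain ⟨i, hi⟩ := hg.exists_Psi
  have hraw : ∀ n, ∃ s, rawPhi (join B (codeIndex i Z)) n s = some (g n) := fun n => by
    obtain ⟨s, hs⟩ := hi n
    exact ⟨max i s, by rw [rawPhi_codeIndex (le_max_left _ _), Psi_mono (le_max_right _ _) hs]⟩
  have hdom : codeIndex i Z ∈ domPhi B :=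
    exists_Phi_isSome fun n => (hraw n).imp fun s hs => ⟨g n, hs⟩
  filter_upwards [hZ i hdom] with k hk
  obtain ⟨v, hv, hvr⟩ := Phi_isSome_iff.1 hk k le_rfl
  obtain ⟨s, hs⟩ := hraw k
  have h1 := rawPhi_mono (le_max_left (f k) s) hvr
  rw [rawPhi_mono (le_max_right (f k) s) hs] at h1
  rwa [Option.some_injective _ h1]

theorem uniformlyAEDominating_of_over_empty {f : ℕ → ℕ}
    (h : UniformlyAEDominatingOver (fun _ => false) f) : UniformlyAEDominating f := by
  filter_upwards [h] with Z hZ g hg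
  refine hZ g (TuringReducible.trans hg (RecursiveIn.iff_nat.2 ?_))
  set X := join (fun _ => false) Z with hX
  have hO : Nat.RecursiveIn {(char X : ℕ →. ℕ)} (char X) := .oracle _ rfl
  refine (recursiveIn_comp hO
    (recursiveIn_of_primrec (f := fun n => 2 * n + 1) (Primrec.succ.comp
      (Primrec.nat_mul.comp (Primrec.const 2) Primrec.id)))).of_eq_tot fun n => ?_
  simp [hX, char, join_two_mul_add_one]

/-- The dense sets that make the generic function total and dominating. -/
def dominatingFamily (B : Cantor) : Set (Set (Condition B)) :=
  Set.range (longStem B) ∪ Set.range (smallEps B)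

theorem countable_dominatingFamily (B : Cantor) : (dominatingFamily B).Countable :=
  (Set.countable_range _).union (Set.countable_range _)

theorem forcingDense_of_mem_dominatingFamily {B : Cantor} :
    ∀ D ∈ dominatingFamily B, ForcingDense D := by
  rintro _ (⟨n, rfl⟩ | ⟨n, rfl⟩)
  exacts [forcingDense_longStem B n, forcingDense_smallEps B n]

theorem exists_generic_dominating {B : Cantor} {G : Order.PFilter (Condition B)}
    (hG : ∀ D ∈ dominatingFamily B, ∃ p ∈ D, p ∈ G) :
    ∃ f, IsGenericFunction G f ∧ UniformlyAEDominatingOver B f := by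
  have h := fun n => hG _ (Or.inl ⟨n, rfl⟩)
  obtain ⟨f, hf⟩ := exists_isGenericFunction h
  exact ⟨f, hf, uniformlyAEDominatingOver_of_stage
    (hf.ae_eventually_mem_stage h fun n => hG _ (Or.inr ⟨n, rfl⟩))⟩

/-! ### Cone avoidance -/

/-- The functional on finite oracles given by a code. -/
def codeFunctional (c : Nat.Partrec.Code) : List ℕ → ℕ →. ℕ :=
  fun σ n => c.eval (Encodable.encode (σ, n))

/-- Passing to codes leaves only countably many functionals, hence countably many dense sets to
meet. -/
theorem Reducible.exists_code {g h : ℕ → ℕ} (H : Reducible g h) :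
    ∃ c, MonotoneFunctional (codeFunctional c) ∧
      ∀ n, ∃ k, g n ∈ codeFunctional c (initSeg h k) n := by
  obtain ⟨F, pF, mF, cF⟩ := H.exists_functional
  obtain ⟨c, hc⟩ := Nat.Partrec.Code.exists_code.1 pF
  have : codeFunctional c = F := by
    funext σ n
    refine Part.ext fun v => ?_
    unfold codeFunctional
    rw [hc]
    simp
  exact ⟨c, by rwa [this], by rwa [this]⟩

/-- The part of `B ⊕ f` determined by the initial segment `g` of `f`. -/
def joinSeg (B : Cantor) (g : List ℕ) : List ℕ :=
  initSeg (join (char B) fun n => g.getD n 0) (2 * g.length)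

theorem initSeg_congr {α : Type} {f g : ℕ → α} {k : ℕ} (h : ∀ n < k, f n = g n) :
    initSeg f k = initSeg g k :=
  List.map_congr_left fun n hn => h n (List.mem_range.1 hn)

theorem joinSeg_congr {B B' : Cantor} {g : List ℕ} {f : ℕ → ℕ} {l : ℕ}
    (hB : ∀ n < l, B n = B' n) (hg : ∀ n < l, g.getD n 0 = f n) :
    initSeg (join (char B) fun n => g.getD n 0) (2 * l) = initSeg (join (char B') f) (2 * l) := by
  refine initSeg_congr fun n hn => ?_
  unfold join
  split_ifs
  · simp only [char, hB (n / 2) (by omega)]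
  · exact hg _ (by omega)

theorem joinSeg_initSeg (B : Cantor) (f : ℕ → ℕ) (k : ℕ) :
    joinSeg B (initSeg f k) = initSeg (join (char B) f) (2 * k) := by
  have hlen : (initSeg f k).length = k := by simp [initSeg]
  unfold joinSeg
  rw [hlen]
  exact joinSeg_congr (fun _ _ => rfl) fun n hn => initSeg_getD f 0 hn

/-- `Φ(B ⊕ Z; n₀)` converges by stage `s₀`, but the values of `g` from `n` on do not all bound
the convergence of `Φ(B ⊕ Z)`. -/
def escapes (n₀ s₀ n : ℕ) (g : List ℕ) (B Z : Cantor) : Bool :=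
  (Phi (join B Z) n₀ s₀).isSome &&
    !((List.range g.length).all fun k => decide (k < n) || (Phi (join B Z) k (g.getD k 0)).isSome)

theorem setOf_escapes (n₀ s₀ n : ℕ) (g : List ℕ) (B : Cantor) :
    {Z | escapes n₀ s₀ n g B Z = true} = stage B n₀ s₀ \ boundedBy B n g := by
  ext Z
  rw [Set.mem_sdiff, mem_boundedBy]
  simp only [escapes, stage, Set.mem_ofPred_eq, Bool.and_eq_true, Bool.not_eq_true',
    ← Bool.not_eq_true, List.all_eq_true, List.mem_range, Bool.or_eq_true, decide_eq_true_eq]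
  refine and_congr Iff.rfl (not_congr (forall₂_congr fun k _ => ?_))
  rw [← not_lt (a := k), or_iff_not_imp_left]

/-- All stages in `s₀` and `g` are decided by oracles of length `m`. -/
def Within (s₀ : ℕ) (g : List ℕ) (m : ℕ) : Prop :=
  4 * s₀ + 4 ≤ m ∧ g.length ≤ m ∧ ∀ a ∈ g, 4 * a + 4 ≤ m

instance (s₀ : ℕ) (g : List ℕ) (m : ℕ) : Decidable (Within s₀ g m) :=
  inferInstanceAs (Decidable (_ ∧ _ ∧ _))

theorem exists_within (s₀ : ℕ) (g : List ℕ) : ∃ m, Within s₀ g m := by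
  refine ⟨4 * s₀ + 4 + g.length + (4 * g.sum + 4), by omega, by omega, fun a ha => ?_⟩
  have := List.single_le_sum (fun _ _ => Nat.zero_le _) a ha
  omega

theorem escapes_congr {n₀ s₀ n : ℕ} {g : List ℕ} {m : ℕ} (hm : Within s₀ g m) {B B' Z Z' : Cantor}
    (hB : ∀ j < m, B j = B' j) (hZ : ∀ j < m, Z j = Z' j) :
    escapes n₀ s₀ n g B Z = escapes n₀ s₀ n g B' Z' := by
  have h0 : Phi (join B Z) n₀ s₀ = Phi (join B' Z') n₀ s₀ :=
    Phi_join_congr (fun j hj => hB j (hj.trans_le hm.1)) fun j hj => hZ j (hj.trans_le hm.1)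
  have h1 : (List.range g.length).all
        (fun k => decide (k < n) || (Phi (join B Z) k (g.getD k 0)).isSome) =
      (List.range g.length).all
        fun k => decide (k < n) || (Phi (join B' Z') k (g.getD k 0)).isSome := by
    refine List.all_congr rfl fun k => ?_
    have hle : 4 * g.getD k 0 + 4 ≤ m := by
      rcases lt_or_ge k g.length with hk | hk
      · rw [List.getD_eq_getElem _ _ hk]
        exact hm.2.2 _ (List.getElem_mem hk)
      -- Past the end of `g` the default stage is `0`, whose use `4` is covered by the first clause
      -- of `Within`.
      · rw [List.getD_eq_default _ _ hk]
        exact le_trans (by omega) hm.1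
    rw [Phi_join_congr (fun j hj => hB j (hj.trans_le hle)) fun j hj => hZ j (hj.trans_le hle)]
  unfold escapes
  rw [h0, h1]

/-- The number of strings of length `m` that witness `escapes`. -/
def escapeCount (n₀ s₀ n : ℕ) (g : List ℕ) (B : Cantor) (m : ℕ) : ℕ :=
  Nat.count (fun t => escapes n₀ s₀ n g B t.testBit = true) (2 ^ m)

/-- The set is decided by `m` bits, so its measure is a count divided by `2 ^ m`. Allowing `B'` to
differ from `B` beyond `m` lets a finite part of the oracle run the test. -/
theorem measure_stage_diff_boundedBy_lt_iff {n₀ s₀ n : ℕ} {g : List ℕ} {m M : ℕ}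
    (hm : Within s₀ g m) (hM : 0 < M) {B B' : Cantor} (hB : ∀ j < m, B j = B' j) :
    coinMeasure.real (stage B n₀ s₀ \ boundedBy B n g) < 1 / M ↔
      escapeCount n₀ s₀ n g B' m * M < 2 ^ m := by
  have hset : stage B n₀ s₀ \ boundedBy B n g = {Z | escapes n₀ s₀ n g B' Z = true} := by
    rw [← setOf_escapes]
    ext Z
    simp only [Set.mem_ofPred_eq, escapes_congr hm hB fun _ _ => rfl]
  rw [hset, coinMeasure_real_eq_count (p := fun Z => escapes n₀ s₀ n g B' Z = true) (m := m)
    fun X Y h => by rw [escapes_congr hm (fun _ _ => rfl) h]]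
  have hM' : (0 : ℝ) < M := by exact_mod_cast hM
  rw [inv_pow, ← div_eq_mul_inv, div_lt_div_iff₀ (by positivity) hM', one_mul]
  unfold escapeCount
  exact_mod_cast Iff.rfl

section Effectivity

variable {α : Type} [Primcodable α]

theorem primrec_escapes {n₀ s₀ n : ℕ} {g : α → List ℕ} {X Y : α → Cantor} (hg : Primrec g)
    (hX : Primrec₂ X) (hY : Primrec₂ Y) :
    Primrec fun a => escapes n₀ s₀ n (g a) (X a) (Y a) := by
  refine Primrec.and.comp (Primrec.option_isSome.comp (primrec_Phi (primrec_join hX hY)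
    (Primrec.const _) (Primrec.const _))) (Primrec.not.comp (primrec_all
      (Primrec.list_range.comp (Primrec.list_length.comp hg)) (Primrec.or.comp
        (Primrec.nat_lt.comp Primrec.snd (Primrec.const _)).decide (Primrec.option_isSome.comp
          (primrec_Phi (α := α × ℕ) ?_ Primrec.snd
            ((Primrec.list_getD 0).comp (hg.comp Primrec.fst) Primrec.snd))))))
  exact (primrec_join hX hY).comp (Primrec.fst.comp Primrec.fst) Primrec.snd

theorem primrec_two_pow : Primrec fun m : ℕ => 2 ^ m :=
  (Primrec.nat_rec₁ 1 (f := fun _ r => 2 * r)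
    (Primrec.nat_mul.comp (Primrec.const 2) Primrec.snd)).of_eq fun m => by
      induction m with
      | zero => rfl
      | succ m ih => rw [pow_succ, ← ih, mul_comm]

theorem primrec_testBit : Primrec₂ Nat.testBit :=
  (Primrec.eq.comp (Primrec.nat_mod.comp (Primrec.nat_div.comp Primrec.fst
    (primrec_two_pow.comp Primrec.snd)) (Primrec.const 2)) (Primrec.const 1)).decide.of_eq
    fun _ => (Nat.testBit_eq_decide_div_mod_eq).symm

theorem primrec_count {p : α → ℕ → Bool} {n : α → ℕ} (hp : Primrec₂ p) (hn : Primrec n) :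
    Primrec fun a => Nat.count (fun t => p a t = true) (n a) := by
  refine (Primrec.nat_rec' (g := fun _ => 0) (h := fun a q => q.2 + bif p a q.1 then 1 else 0)
    hn (Primrec.const 0) (Primrec.nat_add.comp (Primrec.snd.comp Primrec.snd) (Primrec.cond
      (hp.comp Primrec.fst (Primrec.fst.comp Primrec.snd)) (Primrec.const 1)
      (Primrec.const 0)))).of_eq fun a => ?_
  induction n a with
  | zero => rfl
  | succ k ih => rw [Nat.count_succ, ← ih, ← cond_eq_ite]

theorem primrec_escapeCount {n₀ s₀ n : ℕ} {g : α → List ℕ} {X : α → Cantor} {m : α → ℕ}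
    (hg : Primrec g) (hX : Primrec₂ X) (hm : Primrec m) :
    Primrec fun a => escapeCount n₀ s₀ n (g a) (X a) (m a) :=
  primrec_count (p := fun a t => escapes n₀ s₀ n (g a) (X a) t.testBit)
    (primrec_escapes (α := α × ℕ) (hg.comp Primrec.fst)
      (hX.comp (Primrec.fst.comp Primrec.fst) Primrec.snd)
      (primrec_testBit.comp (Primrec.snd.comp Primrec.fst) Primrec.snd))
    (primrec_two_pow.comp hm)

theorem primrec_initSeg {σ : Type} [Primcodable σ] {X : α → ℕ → σ} {k : α → ℕ} (hX : Primrec₂ X)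
    (hk : Primrec k) : Primrec fun a => initSeg (X a) (k a) :=
  Primrec.list_map (Primrec.list_range.comp hk) hX

theorem primrec_joinSeg {g : α → List ℕ} {X : α → Cantor} (hg : Primrec g) (hX : Primrec₂ X) :
    Primrec fun a => joinSeg (X a) (g a) :=
  primrec_initSeg (primrec_join ((Primrec.dom_finite Bool.toNat).comp hX)
    ((Primrec.list_getD 0).comp (hg.comp Primrec.fst) Primrec.snd))
    (Primrec.nat_mul.comp (Primrec.const 2) (Primrec.list_length.comp hg))

theorem primrecPred_within {s₀ : ℕ} {g : α → List ℕ} {m : α → ℕ} (hg : Primrec g)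
    (hm : Primrec m) : PrimrecPred fun a => Within s₀ (g a) (m a) := by
  refine (Primrec.nat_le.comp (Primrec.const _) hm).and
    ((Primrec.nat_le.comp (Primrec.list_length.comp hg) hm).and ?_)
  refine PrimrecPred.of_eq (p := fun a => ((g a).all fun b => decide (4 * b + 4 ≤ m a)) = true)
    ?_ fun a => by simp
  refine Primrec.eq.comp (primrec_all hg ?_) (Primrec.const true)
  exact (Primrec.nat_le.comp (Primrec.nat_add.comp (Primrec.nat_mul.comp (Primrec.const 4)
    Primrec.snd) (Primrec.const 4)) (hm.comp Primrec.fst)).decide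

end Effectivity

/-- One step of the search, with the initial segment `σ` of `B`, for an extension `g` of `f`
such that few `Z` escape `g` and the functional with code `c` converges at `x` on `B ⊕ g`. -/
def searchStep (c : Nat.Partrec.Code) (n₀ s₀ M : ℕ) (f : List ℕ) (q : List Bool × ℕ × ℕ) :
    Option ℕ :=
  -- The search parameter codes both the string appended to `f` and a bound on the computation
  -- steps.
  let d := (Encodable.decode (α := List ℕ × ℕ) q.2.1).getD ([], 0)
  let g := f ++ d.1
  -- The padding by `false` is harmless: `Within` ensures that only bits inside `σ` are consulted.
  let B : Cantor := fun n => q.1.getD n false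
  if Within s₀ g q.1.length ∧ escapeCount n₀ s₀ f.length g B q.1.length * M < 2 ^ q.1.length then
    Nat.Partrec.Code.evaln d.2 c (Encodable.encode (joinSeg B g, q.2.2))
  else none

theorem primrec_searchStep (c : Nat.Partrec.Code) (n₀ s₀ M : ℕ) (f : List ℕ) :
    Primrec (searchStep c n₀ s₀ M f) := by
  have hd : Primrec fun q : List Bool × ℕ × ℕ =>
      (Encodable.decode (α := List ℕ × ℕ) q.2.1).getD ([], 0) :=
    Primrec.option_getD.comp (Primrec.decode.comp (Primrec.fst.comp Primrec.snd))
      (Primrec.const _)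
  have hg : Primrec fun q : List Bool × ℕ × ℕ =>
      f ++ ((Encodable.decode (α := List ℕ × ℕ) q.2.1).getD ([], 0)).1 :=
    Primrec.list_append.comp (Primrec.const f) (Primrec.fst.comp hd)
  have hB : Primrec₂ fun (q : List Bool × ℕ × ℕ) (n : ℕ) => q.1.getD n false :=
    (Primrec.list_getD false).comp (Primrec.fst.comp Primrec.fst) Primrec.snd
  have hl : Primrec fun q : List Bool × ℕ × ℕ => q.1.length :=
    Primrec.list_length.comp Primrec.fst
  refine Primrec.ite ((primrecPred_within hg hl).and (Primrec.nat_lt.comp (Primrec.nat_mul.comp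
    (primrec_escapeCount hg hB hl) (Primrec.const M)) (primrec_two_pow.comp hl))) ?_
    (Primrec.const none)
  exact Nat.Partrec.Code.primrec_evaln.comp (Primrec.pair (Primrec.pair (Primrec.snd.comp hd)
    (Primrec.const c)) (Primrec.encode.comp (Primrec.pair (primrec_joinSeg hg hB)
      (Primrec.snd.comp Primrec.snd))))

theorem joinSeg_congr_left {B B' : Cantor} {g : List ℕ} (h : ∀ n < g.length, B n = B' n) :
    joinSeg B g = joinSeg B' g :=
  joinSeg_congr h fun _ _ => rfl

/-- If every `x` has an admissible extension of `f` on which the functional converges at `x`, and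
all admissible extensions give correct answers about `A`, then `A ≤_T B`. -/
theorem reducible_of_extensions {A : ℕ → ℕ} {B : Cantor} {c : Nat.Partrec.Code} {n₀ s₀ M : ℕ}
    {f : List ℕ} (hM : 0 < M)
    (sound : ∀ g, f <+: g → coinMeasure.real (stage B n₀ s₀ \ boundedBy B f.length g) < 1 / M →
      ∀ x, ∀ v ∈ codeFunctional c (joinSeg B g) x, v = A x)
    (complete : ∀ x, ∃ g, f <+: g ∧
      coinMeasure.real (stage B n₀ s₀ \ boundedBy B f.length g) < 1 / M ∧
      ∃ v, v ∈ codeFunctional c (joinSeg B g) x) :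
    Reducible A (char B) := by
  have hlen : ∀ k, (initSeg B k).length = k := fun k => by simp [initSeg]
  have hbits : ∀ k, ∀ j < k, B j = (initSeg B k).getD j false := fun k j hj =>
    (initSeg_getD B false hj).symm
  refine reducible_of_search (primrec_searchStep c n₀ s₀ M f) (fun k w x v hv => ?_) fun x => ?_
  · unfold searchStep at hv
    dsimp only at hv
    split_ifs at hv with h
    rw [hlen] at h
    refine sound _ (List.prefix_append _ _)
      ((measure_stage_diff_boundedBy_lt_iff h.1 hM (hbits k)).2 h.2) x v ?_
    rw [joinSeg_congr_left fun j hj => hbits k j (hj.trans_le h.1.2.1)]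
    exact Nat.Partrec.Code.evaln_sound hv
  · obtain ⟨_, ⟨ρ, rfl⟩, hμ, v, hv⟩ := complete x
    obtain ⟨u, hu⟩ := Nat.Partrec.Code.evaln_complete.1 hv
    obtain ⟨m, hm⟩ := exists_within s₀ (f ++ ρ)
    refine ⟨m, Encodable.encode (ρ, u), Option.isSome_iff_exists.2 ⟨v, ?_⟩⟩
    unfold searchStep
    simp only [Encodable.encodek, Option.getD_some, hlen]
    rw [if_pos ⟨hm, (measure_stage_diff_boundedBy_lt_iff hm hM (hbits m)).1 hμ⟩,
      ← joinSeg_congr_left fun j hj => hbits m j (hj.trans_le hm.2.1)]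
    exact hu

/-- The conditions that force that the functional with code `c` does not compute `A` from
`B ⊕ f^G`: either it gives a wrong answer, or it diverges at some `x`. -/
def avoids (A : ℕ → ℕ) (B : Cantor) (c : Nat.Partrec.Code) : Set (Condition B) :=
  {q | (∃ x, ∃ v ∈ codeFunctional c (joinSeg B q.stem) x, v ≠ A x) ∨
    ∃ x, ∀ r ≤ q, ∀ v, v ∉ codeFunctional c (joinSeg B r.stem) x}

theorem measureReal_diff_le (S T U : Set Cantor) :
    coinMeasure.real (S \ U) ≤ coinMeasure.real (S \ T) + coinMeasure.real (T \ U) := by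
  refine (measureReal_mono fun Z hZ => ?_).trans (measureReal_union_le _ _)
  by_cases h : Z ∈ T
  exacts [Or.inr ⟨h, hZ.2⟩, Or.inl ⟨hZ.1, h⟩]

/-- Suppose nothing below `p` avoids. Take `3 / M ≤ ε` and a clopen set `T` within `1 / (2M)` of
`domPhi B` on each side, and call `g` admissible if the part of `T` escaping `g` has measure less
than `1 / M`. Admissible strings then never answer wrongly, and some admissible string answers at
each `x`, so `reducible_of_extensions` computes `A` from `B`. -/
theorem forcingDense_avoids {A : ℕ → ℕ} {B : Cantor} (hA : ¬ Reducible A (char B))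
    (c : Nat.Partrec.Code) : ForcingDense (avoids A B c) := by
  intro p
  have hp : (0 : ℝ) < p.eps := by exact_mod_cast p.eps_pos
  obtain ⟨M, hM, hMp⟩ : ∃ M : ℕ, 0 < M ∧ (3 : ℝ) / M ≤ p.eps := by
    obtain ⟨M, hM⟩ := exists_nat_ge (3 / (p.eps : ℝ))
    have hM0 : (0 : ℝ) < M := (by positivity : (0 : ℝ) < 3 / p.eps).trans_le hM
    exact ⟨M, by exact_mod_cast hM0, by rwa [div_le_comm₀ hM0 hp]⟩
  have hM0 : (0 : ℝ) < M := by exact_mod_cast hM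
  have hMq : (0 : ℚ) < M := by exact_mod_cast hM
  have hM1 : (0 : ℝ) < 1 / M := by positivity
  have h3 : (3 : ℝ) / M = 3 * (1 / M) := by ring
  obtain ⟨n₀, s₀, h1, h2⟩ := exists_stage_approx B (half_pos hM1)
  by_contra! hcon
  refine hA (reducible_of_extensions (c := c) (n₀ := n₀) (s₀ := s₀) (f := p.stem) hM
    (fun g hg hμ x v hv => ?_) fun x => ?_)
  · by_contra hne
    have hd := measureReal_diff_le (domPhi B) (stage B n₀ s₀) (boundedBy B p.stem.length g)
    -- The part of `domPhi B` escaping `g` has measure below `1 / (2M) + 1 / M`; adding the new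
    -- bound `1 / M` stays below `3 / M ≤ ε`.
    refine hcon ⟨g, 1 / M, by positivity⟩ (Or.inl ⟨x, v, hv, hne⟩) ⟨hg, ?_, fun _ => ?_⟩
    · have : ((1 / M : ℚ) : ℝ) ≤ p.eps := by
        push_cast
        linarith
      exact_mod_cast this
    · push_cast
      linarith
  · by_contra! hx
    have h0 : (0 : ℚ) < 1 / M / 2 := by positivity
    have hle : (1 / M / 2 : ℚ) ≤ p.eps := by
      have : ((1 / M / 2 : ℚ) : ℝ) ≤ p.eps := by
        push_cast
        linarith
      exact_mod_cast this
    -- Below this condition every stem is admissible: its escaping part of `domPhi B` is under `1 /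
    -- (2M)`, and passing to `T` adds less than `1 / (2M)`. Hence divergence on admissible strings
    -- is divergence forced.
    refine hcon ⟨p.stem, 1 / M / 2, h0⟩ (Or.inr ⟨x, fun r hr => hx _ hr.1 ?_⟩)
      (extends_of_eps_le p h0 hle)
    -- With an unchanged stem the order gives no measure bound, but then there are no new values to
    -- escape.
    by_cases hstem : p.stem = r.stem
    · have : stage B n₀ s₀ \ boundedBy B p.stem.length r.stem = ∅ := by
        refine Set.sdiff_eq_empty.2 fun Z _ => mem_boundedBy.2 fun k hk hk' => ?_
        rw [hstem] at hk'
        exact absurd hk (not_lt.2 hk')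
      rw [this, measureReal_empty]
      exact hM1
    · have hr' := hr.2.2 hstem
      have hr0 : (0 : ℝ) < r.eps := by exact_mod_cast r.eps_pos
      have hd := measureReal_diff_le (stage B n₀ s₀) (domPhi B)
        (boundedBy B p.stem.length r.stem)
      push_cast at hr'
      linarith

/-- A wrong answer on a stem persists by monotonicity. A correct computation has finite use, so it
already appears on a long enough stem below any given condition of `G`, contradicting forced
divergence. -/
theorem not_reducible_of_avoids {A : ℕ → ℕ} {B : Cantor} {G : Order.PFilter (Condition B)}
    {f : ℕ → ℕ} (hf : IsGenericFunction G f) (h : ∀ n, ∃ p ∈ longStem B n, p ∈ G)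
    (hG : ∀ c, ∃ p ∈ avoids A B c, p ∈ G) : ¬ Reducible A (join (char B) f) := by
  intro hred
  obtain ⟨c, mc, hc⟩ := hred.exists_code
  obtain ⟨p, hp, hpG⟩ := hG c
  rcases hp with ⟨x, v, hv, hne⟩ | ⟨x, hx⟩
  · obtain ⟨k, hk⟩ := hc x
    rw [hf.stem_eq hpG, joinSeg_initSeg] at hv
    exact hne (mc.unique hv hk)
  · obtain ⟨k, hk⟩ := hc x
    obtain ⟨q, hqG, hqp, hlen⟩ := exists_extension_longStem h hpG k
    refine hx q hqp (A x) ?_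
    rw [hf.stem_eq hqG, joinSeg_initSeg]
    exact mc.mem_initSeg (by omega) hk

end AEDom

theorem mainTheorem5 :
    -- The unrelativized forcing (`B = ∅`).
    (AEDom.ForSufficientlyGeneric
      fun G : Order.PFilter (AEDom.Condition fun _ => false) =>
        ∃ f, AEDom.IsGenericFunction G f ∧ AEDom.UniformlyAEDominating f) ∧
    -- The forcing relative to `B`.
    (∀ B : AEDom.Cantor, AEDom.ForSufficientlyGeneric
      fun G : Order.PFilter (AEDom.Condition B) =>
        ∃ f, AEDom.IsGenericFunction G f ∧ AEDom.UniformlyAEDominatingOver B f) ∧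
    -- Cone avoidance.
    (∀ A B : AEDom.Cantor, ¬ AEDom.Reducible (AEDom.char A) (AEDom.char B) →
      AEDom.ForSufficientlyGeneric
        fun G : Order.PFilter (AEDom.Condition B) =>
          ∃ f, AEDom.IsGenericFunction G f ∧
            ¬ AEDom.Reducible (AEDom.char A) (AEDom.join (AEDom.char B) f)) := by
  refine ⟨⟨_, AEDom.countable_dominatingFamily _, AEDom.forcingDense_of_mem_dominatingFamily,
    fun G hG => ?_⟩, fun B => ⟨_, AEDom.countable_dominatingFamily _,
    AEDom.forcingDense_of_mem_dominatingFamily, fun G hG => AEDom.exists_generic_dominating hG⟩,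
    fun A B hA => ⟨Set.range (AEDom.longStem B) ∪ Set.range (AEDom.avoids (AEDom.char A) B),
      (Set.countable_range _).union (Set.countable_range _), ?_, fun G hG => ?_⟩⟩
  · obtain ⟨f, hf, hdom⟩ := AEDom.exists_generic_dominating hG
    exact ⟨f, hf, AEDom.uniformlyAEDominating_of_over_empty hdom⟩
  · rintro _ (⟨n, rfl⟩ | ⟨c, rfl⟩)
    exacts [AEDom.forcingDense_longStem B n, AEDom.forcingDense_avoids hA c]
  · have h := fun n => hG _ (Or.inl ⟨n, rfl⟩)
    obtain ⟨f, hf⟩ := AEDom.exists_isGenericFunction h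
    exact ⟨f, hf, AEDom.not_reducible_of_avoids hf h fun c => hG _ (Or.inr ⟨c, rfl⟩)⟩
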